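/- **Setting.** Let $(\Gamma,d)$ be a countable metric space that is $\nu$-regular: there are $\kappa,\nu>0$ such that every closed ball of radius $n+1$ ($n=0,1,2,\dots$) has at most $\kappa(n+1)^\nu$ points. Attach to every $x\in\Gamma$ a finite-dimensional complex Hilbert space $\mathcal H_x$, and put $\mathcal A_Z=\mathcal B(\bigotimes_{x\in Z}\mathcal H_x)$ for finite $Z\subset\Gamma$, with the operator norm; for $Z\subset\Lambda$ regard $\mathcal A_Z\subset\mathcal A_\Lambda$ through $A\mapsto A\otimes 1$. A dissipative interaction $\mathscr L=\{L_Z\}$ assigns to each finite $Z\subset\Gamma$ a linear map $L_Z$ on $\mathcal A_Z$ of the form $L_Z(A)=i[H,A]+\sum_{j=1}^{\ell}\big(K_j^*AK_j-\tfrac12\{K_j^*K_j,A\}\big)$ with $H=H^*$, $K_j\in\mathcal A_Z$ depending on $Z$. For finite $\Lambda\subset\Gamma$ put $T^\Lambda_t=\exp\big(t\sum_{Z\subset\Lambda}L_Z\big)$ on $\mathcal A_\Lambda$, where $L_Z$ acts as $L_Z\otimes\mathrm{id}_{\Lambda\setminus Z}$. For $F:[0,\infty)\to(0,\infty)$ let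 $\|F\|=\sup_x\sum_yF(d(x,y))$, let $C_F$ be the infimum of all $C$ with $\sum_zF(d(x,z))F(d(z,y))\le C\,F(d(x,y))$ for all $x,y\in\Gamma$, and let $\|\mathscr L\|_F$ be the infimum of all $M$ with $\sum_{Z\ni x,y}\|L_Z\|_{cb}\le M\,F(d(x,y))$ for all $x,y\in\Gamma$, where $\|\cdot\|_{cb}$ is the completely bounded norm. A state $\pi$ on $\mathcal A_\Lambda$ is a local dynamical fixed point of $\mathscr L$ with convergence governed by $g_\Lambda:[0,\infty)\to[0,2]$ if $\pi\circ T^\Lambda_t=\pi$ for all $t\ge0$, and $|(\pi-\omega)(T^\Lambda_t(A))|\le g_\Lambda(t)\|A\|$ for all states $\omega$ on $\mathcal A_\Lambda$, all $A\in\mathcal A_\Lambda$ and all $t\ge0$. **Lemma 3.6.** Let $F(r)=(1+r)^{-\alpha}$ with $\alpha>2\nu+1$, and let $\mathscr L$ be a dissipative interaction with $0<\|\mathscr L\|_F<\infty$. Fix $\epsilon\in(0,\alpha-2\nu-1)$, set $\alpha_\epsilon=\alpha-\nu-1-\epsilon$, and let $0<\delta<1$ satisfy $(1-\delta)\alpha_\epsilon>\nu$.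 Let $\Lambda\subset\Gamma$ be finite and let $\pi$ be a local dynamical fixed point of $\mathscr L$ on $\mathcal A_\Lambda$ with convergence governed by $g_\Lambda$. Let $X,Y\subset\Lambda$ be nonempty with $d(X,Y)=\min_{x\in X,\,y\in Y}d(x,y)>2$, and let $A\in\mathcal A_X$, $B\in\mathcal A_Y$. Then for every $0<\eta<\min\{\delta,(1-\delta)\alpha_\epsilon-\nu\}$, $$|\pi(AB)-\pi(A)\pi(B)|\le \frac{C'\,\|A\|\,\|B\|\,(|X|+|Y|)\,\|\mathscr L\|_F}{(1+d(X,Y))^{(1-\delta)\alpha_\epsilon-\nu-\eta}}+3\|A\|\,\|B\|\,g_\Lambda\!\left(\frac{d(X,Y)^\eta}{e\,v\,2^\eta}\right),$$ where $v=\|\mathscr L\|_F\,C_F$, $C'=\dfrac{3C}{ev}\,2^{(1-\delta)\alpha_\epsilon-\nu-\eta}$, $$C=\frac{\kappa C_\epsilon}{C_F}\Big(\kappa\,2^{2\alpha_\epsilon}2^{1-\delta}(C_\epsilon+C_F)+e\,(C_F+\|F\|)\Big),\qquad C_\epsilon=\sum_{n\ge0}\frac1{(1+n)^{1+\epsilon}}.$$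 -/

import Mathlib

open scoped Matrix.Norms.L2Operator ENNReal

noncomputable section

namespace OpenSpin

/-! ### Geometry and decay functions -/

/-- `Γ` is `ν`-regular with constant `κ`: every closed ball of integer radius `n + 1` is finite, with
at most `κ (n + 1) ^ ν` points. -/
structure IsRegularSpace (Γ : Type*) [MetricSpace Γ] (κ ν : ℝ) : Prop where
  kappa_pos : 0 < κ
  nu_pos : 0 < ν
  ball_finite : ∀ (x : Γ) (n : ℕ), (Metric.closedBall x ((n : ℝ) + 1)).Finite
  ball_card : ∀ (x : Γ) (n : ℕ),
    ((Metric.closedBall x ((n : ℝ) + 1)).ncard : ℝ) ≤ κ * ((n : ℝ) + 1) ^ ν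

/-- The distance `d(X, Y) = inf {d(x, y) : x ∈ X, y ∈ Y}` between finite sets. (It is `0` by
convention if one of them is empty, so `2 < setDist X Y` forces both to be nonempty.) -/
def setDist {Γ : Type*} [MetricSpace Γ] (X Y : Finset Γ) : ℝ :=
  sInf {r : ℝ | ∃ x ∈ X, ∃ y ∈ Y, r = dist x y}

/-- The power law `F(r) = 1 / (1 + r) ^ α`. -/
def powerLaw (α : ℝ) (r : ℝ) : ℝ := 1 / (1 + r) ^ α

/-- `‖F‖ = sup_x ∑_y F(d(x, y))`, as an extended nonnegative number. -/
def decaySum (Γ : Type*) [MetricSpace Γ] (F : ℝ → ℝ) : ℝ≥0∞ :=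
  ⨆ x : Γ, ∑' y : Γ, ENNReal.ofReal (F (dist x y))

/-- The convolution constant `C_F`: the infimum of all `C` such that
`∑_z F(d(x, z)) F(d(z, y)) ≤ C F(d(x, y))` for all `x, y`. -/
def convConst (Γ : Type*) [MetricSpace Γ] (F : ℝ → ℝ) : ℝ≥0∞ :=
  sInf {C : ℝ≥0∞ | ∀ x y : Γ,
    ∑' z : Γ, ENNReal.ofReal (F (dist x z)) * ENNReal.ofReal (F (dist z y)) ≤
      C * ENNReal.ofReal (F (dist x y))}

/-! ### Linear maps on matrix algebras -/

section MatrixMaps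

variable {S : Type*} [Fintype S] [DecidableEq S]

/-- `Φ ⊗ id_n`: the map `Φ` applied to each of the `n × n` blocks of a matrix. -/
def blockMap (n : ℕ) (Φ : Matrix S S ℂ →ₗ[ℂ] Matrix S S ℂ)
    (M : Matrix (S × Fin n) (S × Fin n) ℂ) : Matrix (S × Fin n) (S × Fin n) ℂ :=
  Matrix.of fun p r => Φ (Matrix.of fun a b => M (a, p.2) (b, r.2)) p.1 r.1

/-- The completely bounded norm `sup_n ‖Φ ⊗ id_n‖`, where `‖Φ ⊗ id_n‖` is the norm of
`Φ ⊗ id_n` as a map on matrices with the operator norm. -/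
def cbNorm (Φ : Matrix S S ℂ →ₗ[ℂ] Matrix S S ℂ) : ℝ≥0∞ :=
  ⨆ (n : ℕ) (M : Matrix (S × Fin n) (S × Fin n) ℂ) (_ : ‖M‖ ≤ 1),
    ENNReal.ofReal ‖blockMap n Φ M‖

/-- `L(A) = i[H, A] + ∑_j (K_j* A K_j - ½ {K_j* K_j, A})` for some self-adjoint `H` and finitely
many `K_j`. -/
def IsLindblad (L : Matrix S S ℂ →ₗ[ℂ] Matrix S S ℂ) : Prop :=
  ∃ H : Matrix S S ℂ, H.IsHermitian ∧ ∃ (l : ℕ) (K : Fin l → Matrix S S ℂ), ∀ A : Matrix S S ℂ,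
    L A = Complex.I • (H * A - A * H) +
      ∑ j, (star (K j) * A * K j -
        (1 / 2 : ℂ) • (star (K j) * K j * A + A * (star (K j) * K j)))

/-- States: unital positive linear functionals. -/
structure IsState (π : Matrix S S ℂ →ₗ[ℂ] ℂ) : Prop where
  map_one : π 1 = 1
  nonneg : ∀ M : Matrix S S ℂ, 0 ≤ (π (star M * M)).re ∧ (π (star M * M)).im = 0

end MatrixMaps

/-! ### Quantum spin systems

The Hilbert space at the site `x` is `ℂ ^ (q x)`. An orthonormal basis of the tensor product over
`Λ` is indexed by the configurations on `Λ`, and the algebra of observables in `Λ` consists of the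
operators on that tensor product, written as matrices in this basis, with the operator norm. -/

variable {Γ : Type*} [DecidableEq Γ] {q : Γ → ℕ}

/-- Configurations on `Λ`. -/
abbrev Config (q : Γ → ℕ) (Λ : Finset Γ) : Type _ := (x : Λ) → Fin (q x)

/-- The algebra of observables in `Λ`, with the operator norm. -/
abbrev Obs (q : Γ → ℕ) (Λ : Finset Γ) : Type _ := Matrix (Config q Λ) (Config q Λ) ℂ

/-- Restriction of a configuration to a smaller set. -/
def restrictConfig {Z Λ : Finset Γ} (h : Z ⊆ Λ) (σ : Config q Λ) : Config q Z :=
  fun x => σ ⟨x, h x.2⟩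

/-- The configuration that equals `a` on `Z` and `σ` elsewhere. -/
def overrideConfig {Z Λ : Finset Γ} (σ : Config q Λ) (a : Config q Z) : Config q Λ :=
  fun x => if hx : (x : Γ) ∈ Z then a ⟨x, hx⟩ else σ x

/-- The embedding `A ↦ A ⊗ 1` of the observables in `Z` into those in `Λ`. -/
def embed {Z Λ : Finset Γ} (h : Z ⊆ Λ) (A : Obs q Z) : Obs q Λ :=
  Matrix.of fun σ τ =>
    if ∀ x : Λ, (x : Γ) ∉ Z → σ x = τ x then A (restrictConfig h σ) (restrictConfig h τ) else 0

/-- The extension `Φ ⊗ id` of a linear map on the observables in `Z` to the observables in `Λ`. -/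
def extend {Z Λ : Finset Γ} (h : Z ⊆ Λ) (Φ : Obs q Z →ₗ[ℂ] Obs q Z) : Obs q Λ →ₗ[ℂ] Obs q Λ where
  toFun M := Matrix.of fun σ τ =>
    Φ (Matrix.of fun a b => M (overrideConfig σ a) (overrideConfig τ b))
      (restrictConfig h σ) (restrictConfig h τ)
  map_add' M N := by
    ext σ τ
    exact congrFun (congrFun (Φ.map_add
      (Matrix.of fun a b => M (overrideConfig σ a) (overrideConfig τ b))
      (Matrix.of fun a b => N (overrideConfig σ a) (overrideConfig τ b))) _) _
  map_smul' c M := by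
    ext σ τ
    exact congrFun (congrFun (Φ.map_smul c
      (Matrix.of fun a b => M (overrideConfig σ a) (overrideConfig τ b))) _) _

/-- A dissipative interaction: a linear map of Lindblad form on the observables in `Z`, for every
finite set `Z`. -/
structure DissipativeInteraction (q : Γ → ℕ) where
  map : (Z : Finset Γ) → Obs q Z →ₗ[ℂ] Obs q Z
  lindblad : ∀ Z, IsLindblad (map Z)

/-- The `F`-norm: the infimum of all `M` such that
`∑_{Z ∋ x, y} ‖L_Z‖_cb ≤ M F(d(x, y))` for all `x, y`. -/
def interactionNorm [MetricSpace Γ] (F : ℝ → ℝ) (L : DissipativeInteraction q) : ℝ≥0∞ :=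
  sInf {M : ℝ≥0∞ | ∀ x y : Γ,
    ∑' Z : {Z : Finset Γ // x ∈ Z ∧ y ∈ Z}, cbNorm (L.map Z.1) ≤
      M * ENNReal.ofReal (F (dist x y))}

/-- The finite-volume generator `∑_{Z ⊆ Λ} L_Z`, acting on the observables in `Λ`. -/
def generator (L : DissipativeInteraction q) (Λ : Finset Γ) : Obs q Λ →ₗ[ℂ] Obs q Λ :=
  ∑ Z ∈ Λ.powerset.attach, extend (Finset.mem_powerset.1 Z.2) (L.map Z.1)

/-- The semigroup `exp (t G)` generated by a linear map `G` on a finite-dimensional normed space. -/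
def expSemigroup {E : Type*} [NormedAddCommGroup E] [NormedSpace ℂ E] [FiniteDimensional ℂ E]
    (G : E →ₗ[ℂ] E) (t : ℝ) : E →ₗ[ℂ] E :=
  (NormedSpace.exp ((t : ℂ) • LinearMap.toContinuousLinearMap G) : E →L[ℂ] E).toLinearMap

/-- The finite-volume dynamics `exp (t ∑_{Z ⊆ Λ} L_Z)`. -/
def dynamics (L : DissipativeInteraction q) (Λ : Finset Γ) (t : ℝ) : Obs q Λ →ₗ[ℂ] Obs q Λ :=
  expSemigroup (generator L Λ) t

/-- `π` is a local dynamical fixed point of `L` in `Λ` with convergence governed by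
`g : [0, ∞) → [0, 2]` (the values of `g` at negative times play no role). -/
structure IsLocalDynamicalFixedPoint (L : DissipativeInteraction q) (Λ : Finset Γ)
    (π : Obs q Λ →ₗ[ℂ] ℂ) (g : ℝ → ℝ) : Prop where
  isState : IsState π
  invariant : ∀ t : ℝ, 0 ≤ t → ∀ A : Obs q Λ, π (dynamics L Λ t A) = π A
  range : ∀ t : ℝ, 0 ≤ t → g t ∈ Set.Icc (0 : ℝ) 2
  convergence : ∀ ω : Obs q Λ →ₗ[ℂ] ℂ, IsState ω → ∀ (A : Obs q Λ) (t : ℝ), 0 ≤ t →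
    ‖π (dynamics L Λ t A) - ω (dynamics L Λ t A)‖ ≤ g t * ‖A‖

/-! ### Constants -/

/-- `C_ε = ∑_{n ≥ 0} 1 / (1 + n) ^ (1 + ε)`. -/
def zetaConst (ε : ℝ) : ℝ := ∑' n : ℕ, 1 / (1 + (n : ℝ)) ^ (1 + ε)

/-- `α_ε = α - ν - 1 - ε`. -/
def reducedExponent (α ν ε : ℝ) : ℝ := α - ν - 1 - ε

/-- `C = (κ C_ε / C_F) (κ 2 ^ (2 α_ε) 2 ^ (1 - δ) (C_ε + C_F) + e (C_F + ‖F‖))` for the power law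
`F` of exponent `α`. -/
def localityConst (Γ : Type*) [MetricSpace Γ] (κ ν α ε δ : ℝ) : ℝ :=
  κ * zetaConst ε / (convConst Γ (powerLaw α)).toReal *
    (κ * 2 ^ (2 * reducedExponent α ν ε) * 2 ^ (1 - δ) *
        (zetaConst ε + (convConst Γ (powerLaw α)).toReal) +
      Real.exp 1 * ((convConst Γ (powerLaw α)).toReal + (decaySum Γ (powerLaw α)).toReal))

/-- The velocity `v = ‖L‖_F C_F` for the power law `F` of exponent `α`. -/
def velocity [MetricSpace Γ] (α : ℝ) (L : DissipativeInteraction q) : ℝ :=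
  (interactionNorm (powerLaw α) L).toReal * (convConst Γ (powerLaw α)).toReal

/-- `C' = (3 C / (e v)) 2 ^ ((1 - δ) α_ε - ν - η)`. -/
def correlationConst [MetricSpace Γ] (κ ν α ε δ η : ℝ) (L : DissipativeInteraction q) : ℝ :=
  3 * localityConst Γ κ ν α ε δ / (Real.exp 1 * velocity α L) *
    2 ^ ((1 - δ) * reducedExponent α ν ε - ν - η)

end OpenSpin

end

/-!
Let `r = d(X, Y) / 2`. Keep only the terms of the generator on regions of diameter at most
`r ^ (1 - δ)` lying in the `r`-neighbourhood of `X` or in that of `Y`. By Duhamel's formula the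
error on an observable in `X ∪ Y` is the time integral of the dropped terms applied to the evolved
observable: the terms of long range are small by the decay of the interaction, and those of short
range are far from `X ∪ Y`, so a Lieb–Robinson bound for the truncated dynamics, whose finite range
`R = r ^ (1 - δ)` yields the kernel `F(d) exp(-d / R)`, controls them up to the time
`t = r ^ η / (e v)`.

The truncated dynamics acts independently on the two disjoint neighbourhoods, hence
`ψ = ω ∘ T'_t` satisfies `ψ(AB) = ψ(A) ψ(B)` when `ω` is a pure product state. Since
`π = π ∘ T_t` is close to `ω ∘ T_t` by the convergence to the fixed point, `π` inherits this
factorization up to the two errors.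
-/

noncomputable section

namespace OpenSpin

/-! ### One-parameter semigroups of bounded operators -/

section Flow

open Filter Topology

variable {E : Type*} [NormedAddCommGroup E] [NormedSpace ℂ E]

/-- The one-parameter group `exp (t G)` of a bounded operator `G`. In finite dimension it is
`expSemigroup`, as a continuous linear map. -/
def flow (G : E →L[ℂ] E) (t : ℝ) : E →L[ℂ] E := NormedSpace.exp ((t : ℂ) • G)

@[simp] theorem flow_zero (G : E →L[ℂ] E) : flow G 0 = 1 := by
  simp [flow]

theorem commute_flow {G D : E →L[ℂ] E} (h : Commute D G) (t : ℝ) : Commute D (flow G t) :=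
  (h.smul_right (t : ℂ)).exp_right

variable [CompleteSpace E]

theorem hasDerivAt_flow (G : E →L[ℂ] E) (t : ℝ) :
    HasDerivAt (fun s : ℝ => flow G s) (G * flow G t) t := by
  have h := hasDerivAt_exp_smul_const' (𝕂 := ℂ) G (t : ℂ)
  simpa [flow, Function.comp_def] using
    h.scomp (𝕜 := ℝ) t (Complex.ofRealCLM.hasDerivAt (x := t))

theorem hasDerivAt_flow_apply (G : E →L[ℂ] E) (a : E) (t : ℝ) :
    HasDerivAt (fun s : ℝ => flow G s a) (G (flow G t a)) t := by
  simpa [Function.comp_def] using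
    ((ContinuousLinearMap.apply ℂ E a).restrictScalars ℝ).hasFDerivAt.comp_hasDerivAt t
      (hasDerivAt_flow G t)

theorem continuous_flow_apply (G : E →L[ℂ] E) (a : E) : Continuous fun s : ℝ => flow G s a :=
  continuous_iff_continuousAt.2 fun s => (hasDerivAt_flow_apply G a s).continuousAt

theorem hasDerivAt_flow_sub_apply (G : E →L[ℂ] E) {f : ℝ → E} {f' : E} {t s : ℝ}
    (hf : HasDerivAt f f' s) :
    HasDerivAt (fun u : ℝ => flow G (t - u) (f u)) (flow G (t - s) (f' - G (f s))) s := by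
  have hflow : HasDerivAt (fun u : ℝ => (flow G (t - u)).restrictScalars ℝ)
      ((-(G * flow G (t - s))).restrictScalars ℝ) s := by
    have := (hasDerivAt_flow G (t - s)).scomp s ((hasDerivAt_id s).const_sub t)
    exact (ContinuousLinearMap.restrictScalarsL ℂ E E ℝ ℝ).hasFDerivAt.comp_hasDerivAt s
      (by simpa [Function.comp_def] using this)
  have hcomm : G * flow G (t - s) = flow G (t - s) * G := (commute_flow (.refl G) (t - s)).eq
  convert! hflow.clm_apply hf using 1
  rw [hcomm]
  simp [sub_eq_neg_add]

theorem norm_flow_apply_le {G : E →L[ℂ] E} {c : ℝ}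
    (hG : ∀ h : ℝ, 0 ≤ h → ∀ a, ‖a + (h : ℂ) • G a‖ ≤ (1 + c * h ^ 2) * ‖a‖)
    {t : ℝ} (ht : 0 ≤ t) (a : E) : ‖flow G t a‖ ≤ ‖a‖ := by
  refine image_le_of_liminf_slope_right_le_deriv_boundary (f := fun s => ‖flow G s a‖)
    (B := fun _ => ‖a‖) (B' := fun _ => 0) (continuous_flow_apply G a).norm.continuousOn
    (by simp) continuousOn_const (fun s _ => (hasDerivAt_const s _).hasDerivWithinAt) ?_
    (Set.right_mem_Icc.2 ht)
  intro s _ r hr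
  refine Eventually.frequently ?_
  set u := flow G s a
  have hremainder : Tendsto
      (fun z => ‖z - s‖⁻¹ * ‖flow G z a - u - (z - s) • G u‖ + c * (z - s) * ‖u‖)
      (𝓝[>] s) (𝓝 0) := by
    have hc : Continuous fun z => c * (z - s) * ‖u‖ := by fun_prop
    simpa using ((hasDerivAt_iff_tendsto.1 (hasDerivAt_flow_apply G a s)).add
      (by simpa using hc.tendsto s)).mono_left nhdsWithin_le_nhds
  filter_upwards [hremainder.eventually (gt_mem_nhds hr), self_mem_nhdsWithin] with z hz hsz
  have hh : 0 < z - s := sub_pos.2 hsz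
  refine lt_of_le_of_lt ?_ hz
  rw [slope_def_field, div_le_iff₀ hh, add_mul, Real.norm_of_nonneg hh.le, mul_right_comm,
    inv_mul_cancel₀ hh.ne', one_mul]
  have hstep := hG (z - s) hh.le u
  rw [Complex.coe_smul] at hstep
  have htri : ‖flow G z a‖ ≤ ‖flow G z a - u - (z - s) • G u‖ + ‖u + (z - s) • G u‖ := by
    refine le_of_eq_of_le ?_ (norm_add_le _ _)
    congr 1
    abel
  linarith

theorem flow_apply_mem {G : E →L[ℂ] E} {p : Submodule ℂ E} (hp : IsClosed (p : Set E))
    (hG : ∀ a ∈ p, G a ∈ p) {a : E} (ha : a ∈ p) (t : ℝ) : flow G t a ∈ p := by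
  have hsum := (ContinuousLinearMap.apply ℂ E a).hasSum
    (NormedSpace.exp_series_hasSum_exp' (𝕂 := ℂ) ((t : ℂ) • G))
  have hpow (n : ℕ) : (((t : ℂ) • G) ^ n) a ∈ p := by
    induction n with
    | zero => simpa using ha
    | succ n ih => rw [pow_succ']; exact p.smul_mem _ (hG _ ih)
  exact hp.mem_of_tendsto hsum
    (Eventually.of_forall fun s => p.sum_mem fun n _ => p.smul_mem _ (hpow n))

theorem flow_apply_mul {R : Type*} [NormedRing R] [NormedAlgebra ℂ R] [CompleteSpace R]
    {G : R →L[ℂ] R} {a b : R}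
    (hG : ∀ s, G (flow G s a * flow G s b) =
      G (flow G s a) * flow G s b + flow G s a * G (flow G s b)) (t : ℝ) :
    flow G t (a * b) = flow G t a * flow G t b := by
  have hderiv (s : ℝ) : HasDerivAt (fun s => flow G (t - s) (flow G s a * flow G s b)) 0 s := by
    convert! hasDerivAt_flow_sub_apply G (t := t)
      ((hasDerivAt_flow_apply G a s).mul (hasDerivAt_flow_apply G b s)) using 1
    simp [hG]
  simpa using is_const_of_deriv_eq_zero (fun s => (hderiv s).differentiableAt)
    (fun s => (hderiv s).deriv) 0 t

end Flow

/-! ### Lindblad maps and states -/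

section LindbladMap

variable {R : Type*} [Ring R] [StarRing R] [Algebra ℂ R] {ι : Type*} [Fintype ι]
  {H a b : R} {K : ι → R}

/-- The Lindblad map with Hamiltonian `H` and jump operators `K`, in an arbitrary complex
`*`-algebra. -/
def lindbladMap (H : R) (K : ι → R) : R →ₗ[ℂ] R :=
  Complex.I • (LinearMap.mulLeft ℂ H - LinearMap.mulRight ℂ H) +
    ∑ j, (LinearMap.mulLeftRight ℂ (star (K j), K j) -
      (1 / 2 : ℂ) • (LinearMap.mulLeft ℂ (star (K j) * K j) +
        LinearMap.mulRight ℂ (star (K j) * K j)))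

theorem lindbladMap_apply (H : R) (K : ι → R) (a : R) :
    lindbladMap H K a = Complex.I • (H * a - a * H) +
      ∑ j, (star (K j) * a * K j -
        (1 / 2 : ℂ) • (star (K j) * K j * a + a * (star (K j) * K j))) := by
  simp only [lindbladMap, LinearMap.add_apply, LinearMap.sub_apply, LinearMap.smul_apply,
    LinearMap.sum_apply, LinearMap.mulLeft_apply, LinearMap.mulRight_apply,
    LinearMap.mulLeftRight_apply]

theorem lindbladMap_apply_one (H : R) (K : ι → R) : lindbladMap H K 1 = 0 := by
  simp [lindbladMap_apply, ← two_smul ℂ, smul_smul]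

theorem lindbladMap_mul_right (hH : Commute H b) (hK : ∀ j, Commute (K j) b)
    (hK' : ∀ j, Commute (star (K j)) b) (a : R) :
    lindbladMap H K (a * b) = lindbladMap H K a * b := by
  rw [lindbladMap_apply, lindbladMap_apply, add_mul, Finset.sum_mul, smul_mul_assoc]
  congr 1
  · rw [sub_mul, ← mul_assoc, mul_assoc a b, ← hH.eq, mul_assoc a H b]
  · refine Finset.sum_congr rfl fun j _ => ?_
    have hKK : Commute (star (K j) * K j) b := (hK' j).mul_left (hK j)
    rw [sub_mul, smul_mul_assoc, add_mul, mul_assoc a b, ← hKK.eq]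
    simp only [mul_assoc, (hK j).eq]

theorem lindbladMap_mul_left (hH : Commute H a) (hK : ∀ j, Commute (K j) a)
    (hK' : ∀ j, Commute (star (K j)) a) (b : R) :
    lindbladMap H K (a * b) = a * lindbladMap H K b := by
  rw [lindbladMap_apply, lindbladMap_apply, mul_add, Finset.mul_sum, mul_smul_comm]
  congr 1
  · rw [mul_sub, ← mul_assoc, hH.eq, mul_assoc a H b, mul_assoc a b H]
  · refine Finset.sum_congr rfl fun j _ => ?_
    have hKK : Commute (star (K j) * K j) a := (hK' j).mul_left (hK j)
    rw [mul_sub, mul_smul_comm, mul_add, ← mul_assoc _ a b, ← mul_assoc _ a b, (hK' j).eq, hKK.eq]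
    simp only [mul_assoc]

theorem lindbladMap_eq_zero (hH : Commute H a) (hK : ∀ j, Commute (K j) a)
    (hK' : ∀ j, Commute (star (K j)) a) : lindbladMap H K a = 0 := by
  simpa [lindbladMap_apply_one] using lindbladMap_mul_right hH hK hK' 1

theorem lindbladMap_mem [StarModule ℂ R] {S : StarSubalgebra ℂ R} (hH : H ∈ S)
    (hK : ∀ j, K j ∈ S) (ha : a ∈ S) : lindbladMap H K a ∈ S := by
  have hKK (j : ι) : star (K j) * K j ∈ S := mul_mem (star_mem (hK j)) (hK j)
  rw [lindbladMap_apply]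
  exact add_mem (S.smul_mem (sub_mem (mul_mem hH ha) (mul_mem ha hH)) _) <|
    sum_mem fun j _ => sub_mem (mul_mem (mul_mem (star_mem (hK j)) ha) (hK j)) <|
      S.smul_mem (add_mem (mul_mem (hKK j) ha) (mul_mem ha (hKK j))) _

theorem lindbladMap_add {ι' : Type*} [Fintype ι'] (H H' : R) (K : ι → R) (K' : ι' → R) :
    lindbladMap H K + lindbladMap H' K' = lindbladMap (H + H') (Sum.elim K K') := by
  ext a
  simp only [LinearMap.add_apply, lindbladMap_apply, Fintype.sum_sum_type, Sum.elim_inl,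
    Sum.elim_inr, add_mul, mul_add, add_sub_add_comm, smul_add]
  abel

theorem lindbladMap_comp_equiv {ι' : Type*} [Fintype ι'] (e : ι' ≃ ι) (H : R) (K : ι → R) :
    lindbladMap H (K ∘ e) = lindbladMap H K := by
  ext a
  simp only [lindbladMap_apply, Function.comp_apply]
  rw [e.sum_comp fun j => star (K j) * a * K j -
    (1 / 2 : ℂ) • (star (K j) * K j * a + a * (star (K j) * K j))]

/-- The non-self-adjoint generator `W = -iH - ½ ∑ K_j* K_j` of the no-jump evolution. -/
def noJumpGenerator (H : R) (K : ι → R) : R :=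
  -(Complex.I • H) - (1 / 2 : ℂ) • ∑ j, star (K j) * K j

theorem lindbladMap_eq_noJumpGenerator [StarModule ℂ R] (hH : IsSelfAdjoint H) (K : ι → R)
    (a : R) :
    lindbladMap H K a = star (noJumpGenerator H K) * a + a * noJumpGenerator H K +
      ∑ j, star (K j) * a * K j := by
  have hstar : star (noJumpGenerator H K) =
      Complex.I • H - (1 / 2 : ℂ) • ∑ j, star (K j) * K j := by
    simp [noJumpGenerator, hH.star_eq]
  rw [lindbladMap_apply, hstar, noJumpGenerator, Finset.sum_sub_distrib, ← Finset.smul_sum,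
    Finset.sum_add_distrib, ← Finset.sum_mul, ← Finset.mul_sum]
  simp only [sub_mul, mul_sub, mul_neg, smul_mul_assoc, mul_smul_comm, smul_sub, smul_add]
  abel

-- To first order in `h`, `1 + h L` is the completely positive map with Kraus operators
-- `1 + h W` and `√h K_j`.
theorem sum_kraus_eq [StarModule ℂ R] (hH : IsSelfAdjoint H) (K : ι → R) {h : ℝ} (hh : 0 ≤ h)
    (a : R) :
    let W := noJumpGenerator H K
    let V : Option ι → R := fun o => o.elim (1 + (h : ℂ) • W) fun j => ((√h : ℝ) : ℂ) • K j
    ∑ j, star (V j) * a * V j =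
      a + (h : ℂ) • lindbladMap H K a + (h : ℂ) ^ 2 • (star W * a * W) := by
  have hsqrt : ((√h : ℝ) : ℂ) * (√h : ℝ) = h := by
    rw [← Complex.ofReal_mul, Real.mul_self_sqrt hh]
  simp only [Fintype.sum_option, Option.elim, lindbladMap_eq_noJumpGenerator hH, star_add,
    star_smul, star_one, smul_add, Finset.smul_sum, add_mul, mul_add, one_mul, mul_one,
    smul_mul_assoc, mul_smul_comm, smul_smul, RCLike.star_def, Complex.conj_ofReal, hsqrt, pow_two]
  abel

end LindbladMap

section CStarAlgebra

variable {R : Type*} [CStarAlgebra R] {ι : Type*} [Fintype ι]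

open WithCStarModule in
theorem norm_sum_star_mul_mul_le (V : ι → R) (a : R) :
    ‖∑ j, star (V j) * a * V j‖ ≤ ‖∑ j, star (V j) * V j‖ * ‖a‖ := by
  let _ : PartialOrder R := CStarAlgebra.spectralOrder R
  have : StarOrderedRing R := CStarAlgebra.spectralOrderedRing R
  let x : WithCStarModule R (ι → R) := (equiv R (ι → R)).symm fun j => star (V j)
  let y : WithCStarModule R (ι → R) := (equiv R (ι → R)).symm fun j => star (V j) * a
  have hxy : ‖∑ j, star (V j) * a * V j‖ ≤ ‖x‖ * ‖y‖ := by
    simpa [x, y, pi_inner, inner_def] using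
      CStarModule.norm_inner_le (A := R) (WithCStarModule R (ι → R)) (x := x) (y := y)
  have hx : ‖x‖ ^ 2 = ‖∑ j, star (V j) * V j‖ := by
    simp [x, pi_norm_sq, inner_def]
  have hy : ‖y‖ ^ 2 ≤ ‖x‖ ^ 2 * ‖a‖ ^ 2 := by
    have hconj : ∑ j, star (V j) * (a * star a) * V j ≤
        ‖a * star a‖ • ∑ j, star (V j) * V j := by
      rw [Finset.smul_sum]
      exact Finset.sum_le_sum fun j _ =>
        CStarAlgebra.star_left_conjugate_le_norm_smul (hb := .mul_star_self a)
    have hnonneg : 0 ≤ ∑ j, star (V j) * (a * star a) * V j :=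
      Finset.sum_nonneg fun j _ => star_left_conjugate_nonneg (mul_star_self_nonneg a) _
    have := CStarAlgebra.norm_le_norm_of_nonneg_of_le hnonneg hconj
    rw [norm_smul, norm_norm, CStarRing.norm_self_mul_star, ← hx] at this
    have hinner : ‖y‖ ^ 2 = ‖∑ j, star (V j) * (a * star a) * V j‖ := by
      simp [y, pi_norm_sq, inner_def, mul_assoc]
    rwa [hinner, mul_comm, pow_two ‖a‖]
  calc ‖∑ j, star (V j) * a * V j‖ ≤ ‖x‖ * (‖x‖ * ‖a‖) := hxy.trans <| by
        gcongr
        exact le_of_sq_le_sq (by rwa [mul_pow]) (by positivity)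
    _ = ‖∑ j, star (V j) * V j‖ * ‖a‖ := by rw [← mul_assoc, ← pow_two, hx]

theorem norm_add_smul_lindbladMap_le {H : R} (hH : IsSelfAdjoint H) (K : ι → R) {h : ℝ}
    (hh : 0 ≤ h) (a : R) :
    ‖a + (h : ℂ) • lindbladMap H K a‖ ≤
      (1 + 2 * ‖noJumpGenerator H K‖ ^ 2 * h ^ 2) * ‖a‖ := by
  have hkraus := sum_kraus_eq hH K hh
  set W := noJumpGenerator H K
  set V : Option ι → R := fun o => o.elim (1 + (h : ℂ) • W) fun j => ((√h : ℝ) : ℂ) • K j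
  have hW (b : R) : ‖(h : ℂ) ^ 2 • (star W * b * W)‖ ≤ ‖W‖ ^ 2 * h ^ 2 * ‖b‖ := by
    rw [norm_smul, norm_pow, Complex.norm_real, Real.norm_of_nonneg hh]
    calc h ^ 2 * ‖star W * b * W‖ ≤ h ^ 2 * (‖star W‖ * ‖b‖ * ‖W‖) := by
          gcongr
          exact norm_mul₃_le
      _ = ‖W‖ ^ 2 * h ^ 2 * ‖b‖ := by rw [norm_star]; ring
  have hone : ‖(1 : R)‖ ≤ 1 := by
    rcases subsingleton_or_nontrivial R with _ | _
    · simp [Subsingleton.elim (1 : R) 0]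
    · exact CStarRing.norm_one.le
  have hV : ‖∑ j, star (V j) * V j‖ ≤ 1 + ‖W‖ ^ 2 * h ^ 2 := by
    have h1 := hkraus 1
    simp only [mul_one, lindbladMap_apply_one, smul_zero, add_zero] at h1
    rw [h1]
    calc _ ≤ ‖(1 : R)‖ + ‖W‖ ^ 2 * h ^ 2 * ‖(1 : R)‖ :=
          (norm_add_le _ _).trans (add_le_add_right (by simpa using hW 1) _)
      _ ≤ 1 + ‖W‖ ^ 2 * h ^ 2 * 1 := by gcongr
      _ = _ := by rw [mul_one]
  rw [eq_sub_of_add_eq (hkraus a).symm]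
  calc _ ≤ ‖∑ j, star (V j) * a * V j‖ + ‖(h : ℂ) ^ 2 • (star W * a * W)‖ := norm_sub_le _ _
    _ ≤ (1 + ‖W‖ ^ 2 * h ^ 2) * ‖a‖ + ‖W‖ ^ 2 * h ^ 2 * ‖a‖ := by
        refine add_le_add ((norm_sum_star_mul_mul_le V a).trans ?_) (hW a)
        gcongr
    _ = _ := by ring

open scoped ComplexOrder in
theorem norm_apply_le_of_positive [PartialOrder R] [StarOrderedRing R] (f : R →ₚ[ℂ] ℂ) (a : R) :
    ‖f a‖ ≤ ‖f 1‖ * ‖a‖ := by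
  have hnorm (b : R) : ‖f.toPreGNS b‖ ^ 2 = ‖f (star b * b)‖ := by
    rw [← norm_norm (f.toPreGNS b), ← norm_pow, ← Complex.norm_real]
    exact congrArg _ (by simpa using f.preGNS_norm_sq (f.toPreGNS b))
  have hinner : ‖f a‖ ≤ ‖f.toPreGNS 1‖ * ‖f.toPreGNS a‖ := by
    simpa [f.preGNS_inner_def] using norm_inner_le_norm (𝕜 := ℂ) (f.toPreGNS 1) (f.toPreGNS a)
  have hsq : ‖f (star a * a)‖ ≤ ‖f 1‖ * ‖a‖ ^ 2 := by
    simpa [CStarRing.norm_star_mul_self, pow_two] using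
      f.norm_apply_le_of_nonneg _ (star_mul_self_nonneg a)
  refine le_of_sq_le_sq ?_ (by positivity)
  calc ‖f a‖ ^ 2 ≤ ‖f.toPreGNS 1‖ ^ 2 * ‖f.toPreGNS a‖ ^ 2 := by
        rw [← mul_pow]; gcongr
    _ ≤ ‖f 1‖ * (‖f 1‖ * ‖a‖ ^ 2) := by
        rw [hnorm, hnorm, star_one, one_mul]; gcongr
    _ = (‖f 1‖ * ‖a‖) ^ 2 := by ring

end CStarAlgebra

section MatrixAlgebra

variable {S : Type*} [Fintype S] {L M : Matrix S S ℂ →ₗ[ℂ] Matrix S S ℂ}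

theorem isLindblad_iff [DecidableEq S] : IsLindblad L ↔ ∃ H : Matrix S S ℂ, IsSelfAdjoint H ∧
    ∃ (l : ℕ) (K : Fin l → Matrix S S ℂ), L = lindbladMap H K := by
  simp only [IsLindblad, LinearMap.ext_iff, lindbladMap_apply, Matrix.IsHermitian, IsSelfAdjoint,
    Matrix.star_eq_conjTranspose]

theorem IsLindblad.eq_zero [Subsingleton S] (hL : IsLindblad L) : L = 0 := by
  classical
  have hcomm (A B : Matrix S S ℂ) : Commute A B := by
    ext i j
    rw [Subsingleton.elim j i, Matrix.mul_apply, Matrix.mul_apply]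
    refine Finset.sum_congr rfl fun k _ => ?_
    rw [Subsingleton.elim k i, mul_comm]
  obtain ⟨H, -, l, K, rfl⟩ := isLindblad_iff.1 hL
  ext1 A
  exact lindbladMap_eq_zero (hcomm _ _) (fun _ => hcomm _ _) fun _ => hcomm _ _

theorem IsLindblad.add (hL : IsLindblad L) (hM : IsLindblad M) : IsLindblad (L + M) := by
  classical
  obtain ⟨H, hH, l, K, rfl⟩ := isLindblad_iff.1 hL
  obtain ⟨H', hH', l', K', rfl⟩ := isLindblad_iff.1 hM
  refine isLindblad_iff.2 ⟨H + H', hH.add hH', l + l', Sum.elim K K' ∘ finSumFinEquiv.symm, ?_⟩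
  rw [lindbladMap_add, lindbladMap_comp_equiv]

theorem IsLindblad.sum {ι : Type*} (s : Finset ι) {L : ι → Matrix S S ℂ →ₗ[ℂ] Matrix S S ℂ}
    (hL : ∀ i ∈ s, IsLindblad (L i)) : IsLindblad (∑ i ∈ s, L i) := by
  classical
  exact Finset.sum_induction _ _ (fun _ _ => IsLindblad.add)
    (isLindblad_iff.2 ⟨0, .zero _, 0, Fin.elim0, by ext; simp [lindbladMap_apply]⟩) hL

variable [DecidableEq S]

theorem IsLindblad.norm_flow_apply_le (hL : IsLindblad L) {t : ℝ} (ht : 0 ≤ t)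
    (A : Matrix S S ℂ) : ‖flow (LinearMap.toContinuousLinearMap L) t A‖ ≤ ‖A‖ := by
  obtain ⟨H, hH, l, K, hK⟩ := isLindblad_iff.1 hL
  have hbound (h : ℝ) (hh : 0 ≤ h) (B : Matrix S S ℂ) :
      ‖B + (h : ℂ) • LinearMap.toContinuousLinearMap L B‖ ≤
        (1 + 2 * ‖noJumpGenerator H K‖ ^ 2 * h ^ 2) * ‖B‖ := by
    rw [LinearMap.coe_toContinuousLinearMap', hK]
    exact norm_add_smul_lindbladMap_le hH K hh B
  exact OpenSpin.norm_flow_apply_le hbound ht A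

open scoped MatrixOrder ComplexOrder in
theorem IsState.norm_apply_le {π : Matrix S S ℂ →ₗ[ℂ] ℂ} (hπ : IsState π) (M : Matrix S S ℂ) :
    ‖π M‖ ≤ ‖M‖ := by
  have hpos (N : Matrix S S ℂ) (hN : 0 ≤ N) : 0 ≤ π N := by
    obtain ⟨P, rfl⟩ := CStarAlgebra.nonneg_iff_eq_star_mul_self.1 hN
    exact Complex.nonneg_iff.2 ⟨(hπ.nonneg P).1, (hπ.nonneg P).2.symm⟩
  let f : Matrix S S ℂ →ₚ[ℂ] ℂ := PositiveLinearMap.mk₀ π hpos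
  calc ‖f M‖ ≤ ‖f 1‖ * ‖M‖ := norm_apply_le_of_positive f M
    _ = ‖M‖ := by rw [show f 1 = 1 from hπ.map_one, norm_one, one_mul]

end MatrixAlgebra

/-! ### Local observables and local maps -/

section BlockMap

variable {S : Type*} [Fintype S] [DecidableEq S]

theorem norm_submatrix_equiv_le {m n : Type*} [Fintype m] [DecidableEq m] [Fintype n]
    [DecidableEq n] (e : m ≃ n) (M : Matrix n n ℂ) : ‖M.submatrix e e‖ ≤ ‖M‖ := by
  let f : Matrix n n ℂ →⋆ₐ[ℂ] Matrix m m ℂ :=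
    { (Matrix.reindexAlgEquiv ℂ ℂ e.symm).toAlgHom with
      map_star' := fun A => by
        ext i j
        simp [Matrix.star_apply] }
  exact NonUnitalStarAlgHom.norm_apply_le f M

theorem norm_blockMap_le {Φ : Matrix S S ℂ →ₗ[ℂ] Matrix S S ℂ} (hΦ : cbNorm Φ < ⊤) (n : ℕ)
    (M : Matrix (S × Fin n) (S × Fin n) ℂ) : ‖blockMap n Φ M‖ ≤ (cbNorm Φ).toReal * ‖M‖ := by
  have hsmul (c : ℂ) (N : Matrix (S × Fin n) (S × Fin n) ℂ) :
      blockMap n Φ (c • N) = c • blockMap n Φ N := by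
    ext p r
    exact congrFun (congrFun (Φ.map_smul c (Matrix.of fun a b => N (a, p.2) (b, r.2))) _) _
  have hunit (N : Matrix (S × Fin n) (S × Fin n) ℂ) (hN : ‖N‖ ≤ 1) :
      ‖blockMap n Φ N‖ ≤ (cbNorm Φ).toReal :=
    (ENNReal.ofReal_le_iff_le_toReal hΦ.ne).1 <|
      le_iSup_of_le n (le_iSup_of_le N (le_iSup_of_le hN le_rfl))
  rcases eq_or_ne M 0 with rfl | hM
  · have : blockMap n Φ 0 = 0 := by simpa using hsmul 0 0
    simp [this]
  have hscaled := hunit (((‖M‖⁻¹ : ℝ) : ℂ) • M) (by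
    rw [norm_smul, Complex.norm_real, norm_inv, norm_norm, inv_mul_cancel₀ (norm_ne_zero_iff.2 hM)])
  rw [hsmul, norm_smul, Complex.norm_real, norm_inv, norm_norm,
    inv_mul_le_iff₀ (norm_pos_iff.2 hM)] at hscaled
  rwa [mul_comm]

end BlockMap

section Local

open scoped Kronecker

variable {Γ : Type*} [DecidableEq Γ] {q : Γ → ℕ} {Z W X Y Λ : Finset Γ}
  {Φ : Obs q Z →ₗ[ℂ] Obs q Z} {M N : Obs q Λ}

/-- The identification of the configurations on `Λ` with the pairs of a configuration on `Z` and one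
on `Λ \ Z`; it splits the Hilbert space of `Λ` as a tensor product. -/
def splitConfig (h : Z ⊆ Λ) : Config q Λ ≃ Config q Z × Config q (Λ \ Z) where
  toFun σ := (restrictConfig h σ, restrictConfig Finset.sdiff_subset σ)
  invFun p x := if hx : (x : Γ) ∈ Z then p.1 ⟨x, hx⟩ else p.2 ⟨x, by simp [hx]⟩
  left_inv σ := by
    ext x
    by_cases hx : (x : Γ) ∈ Z <;> simp [restrictConfig, hx]
  right_inv p := by
    refine Prod.ext (funext fun x => by simp [restrictConfig]) (funext fun x => ?_)
    have hx : (x : Γ) ∉ Z := (Finset.mem_sdiff.1 x.2).2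
    simp [restrictConfig, hx]

theorem splitConfig_symm_apply (h : Z ⊆ Λ) (σ : Config q Λ) (a : Config q Z) :
    (splitConfig h).symm (a, (splitConfig h σ).2) = overrideConfig σ a := by
  ext x
  by_cases hx : (x : Γ) ∈ Z <;> simp [splitConfig, overrideConfig, restrictConfig, hx]

theorem splitConfig_snd_eq_iff (h : Z ⊆ Λ) (σ τ : Config q Λ) :
    (splitConfig h σ).2 = (splitConfig h τ).2 ↔ ∀ x : Λ, (x : Γ) ∉ Z → σ x = τ x := by
  simp [splitConfig, funext_iff, restrictConfig]

theorem embed_eq_kronecker (h : Z ⊆ Λ) (A : Obs q Z) :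
    embed h A = (A ⊗ₖ (1 : Obs q (Λ \ Z))).submatrix (splitConfig h) (splitConfig h) := by
  ext σ τ
  simp only [embed, Matrix.of_apply, Matrix.submatrix_apply, Matrix.kroneckerMap_apply,
    Matrix.one_apply, splitConfig_snd_eq_iff, mul_ite, mul_one, mul_zero]
  rfl

theorem embed_eq_one_kronecker (h : Z ⊆ Λ) (hW : W ⊆ Λ) (hWZ : W ⊆ Λ \ Z) (B : Obs q W) :
    embed hW B = ((1 : Obs q Z) ⊗ₖ embed hWZ B).submatrix (splitConfig h) (splitConfig h) := by
  ext σ τ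
  simp only [embed, Matrix.of_apply, Matrix.submatrix_apply, Matrix.kroneckerMap_apply,
    Matrix.one_apply, ite_mul, one_mul, zero_mul, ← ite_and]
  refine if_congr ⟨fun hστ => ⟨funext fun x => ?_, fun x hx => ?_⟩, fun ⟨hZ, hW⟩ x hx => ?_⟩ rfl rfl
  · exact hστ ⟨x, h x.2⟩ fun hx => (Finset.mem_sdiff.1 (hWZ hx)).2 x.2
  · exact hστ ⟨x, Finset.sdiff_subset x.2⟩ hx
  · by_cases hxZ : (x : Γ) ∈ Z
    · exact congrFun hZ ⟨x, hxZ⟩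
    · exact hW ⟨x, Finset.mem_sdiff.2 ⟨x.2, hxZ⟩⟩ hx

/-- The embedding `A ↦ A ⊗ 1` as a homomorphism of `*`-algebras. -/
def embedHom (h : Z ⊆ Λ) : Obs q Z →⋆ₐ[ℂ] Obs q Λ where
  toFun := embed h
  map_one' := by simp [embed_eq_kronecker]
  map_mul' A B := by
    simp only [embed_eq_kronecker, Matrix.submatrix_mul_equiv, ← Matrix.mul_kronecker_mul, mul_one]
  map_zero' := by simp [embed_eq_kronecker]
  map_add' A B := by
    simp only [embed_eq_kronecker, Matrix.add_kronecker, Matrix.submatrix_add, Pi.add_apply]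
  commutes' c := by
    simp only [embed_eq_kronecker, Algebra.algebraMap_eq_smul_one, Matrix.smul_kronecker,
      Matrix.one_kronecker_one, Matrix.submatrix_smul, Pi.smul_apply, Matrix.submatrix_one_equiv]
  map_star' A := by
    simp [embed_eq_kronecker, Matrix.star_eq_conjTranspose, Matrix.conjTranspose_kronecker]

theorem embedHom_apply (h : Z ⊆ Λ) (A : Obs q Z) : embedHom h A = embed h A := rfl

theorem norm_embed_le (h : Z ⊆ Λ) (A : Obs q Z) : ‖embed h A‖ ≤ ‖A‖ :=
  NonUnitalStarAlgHom.norm_apply_le (embedHom h) A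

theorem embed_embed (hZX : Z ⊆ X) (hX : X ⊆ Λ) (A : Obs q Z) :
    embed hX (embed hZX A) = embed (hZX.trans hX) A := by
  ext σ τ
  simp only [embed, Matrix.of_apply, ← ite_and]
  refine if_congr ⟨fun ⟨hΛ, hX'⟩ x hx => ?_, fun hστ => ⟨fun x hx => ?_, fun x hx => ?_⟩⟩ rfl rfl
  · by_cases hxX : (x : Γ) ∈ X
    · exact hX' ⟨x, hxX⟩ hx
    · exact hΛ x hxX
  · exact hστ x fun hxZ => hx (hZX hxZ)
  · exact hστ ⟨x, hX x.2⟩ hx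

theorem embed_mul_embed (hZ : Z ⊆ Λ) (hW : W ⊆ Λ) (hWZ : W ⊆ Λ \ Z) (A : Obs q Z) (B : Obs q W) :
    embed hZ A * embed hW B =
      (A ⊗ₖ embed hWZ B).submatrix (splitConfig hZ) (splitConfig hZ) := by
  rw [embed_eq_kronecker, embed_eq_one_kronecker hZ hW hWZ, Matrix.submatrix_mul_equiv,
    ← Matrix.mul_kronecker_mul, mul_one, one_mul]

theorem commute_embed (hZ : Z ⊆ Λ) (hW : W ⊆ Λ) (hd : Disjoint Z W) (A : Obs q Z) (B : Obs q W) :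
    Commute (embed hZ A) (embed hW B) := by
  have hWZ : W ⊆ Λ \ Z := Finset.subset_sdiff.2 ⟨hW, hd.symm⟩
  rw [commute_iff_eq, embed_mul_embed hZ hW hWZ, embed_eq_kronecker hZ,
    embed_eq_one_kronecker hZ hW hWZ, Matrix.submatrix_mul_equiv, ← Matrix.mul_kronecker_mul,
    mul_one, one_mul]

theorem embed_mul_embed_apply_self (hZ : Z ⊆ Λ) (hW : W ⊆ Λ) (hd : Disjoint Z W) (A : Obs q Z)
    (B : Obs q W) (σ : Config q Λ) :
    (embed hZ A * embed hW B) σ σ = embed hZ A σ σ * embed hW B σ σ := by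
  have hWZ : W ⊆ Λ \ Z := Finset.subset_sdiff.2 ⟨hW, hd.symm⟩
  rw [embed_mul_embed hZ hW hWZ, embed_eq_kronecker hZ, embed_eq_one_kronecker hZ hW hWZ]
  simp

theorem embed_mul_apply (h : Z ⊆ Λ) (B : Obs q Z) (M : Obs q Λ) (σ τ : Config q Λ) :
    (embed h B * M) σ τ = ∑ a, B (restrictConfig h σ) a * M (overrideConfig σ a) τ := by
  rw [Matrix.mul_apply, ← (splitConfig h).symm.sum_comp, Fintype.sum_prod_type]
  simp only [embed_eq_kronecker, Matrix.submatrix_apply, Equiv.apply_symm_apply,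
    Matrix.kroneckerMap_apply, Matrix.one_apply, mul_ite, mul_one, mul_zero, ite_mul, zero_mul,
    Finset.sum_ite_eq, Finset.mem_univ, ↓reduceIte, splitConfig_symm_apply]
  rfl

theorem mul_embed_apply (h : Z ⊆ Λ) (B : Obs q Z) (M : Obs q Λ) (σ τ : Config q Λ) :
    (M * embed h B) σ τ = ∑ b, M σ (overrideConfig τ b) * B b (restrictConfig h τ) := by
  rw [Matrix.mul_apply, ← (splitConfig h).symm.sum_comp, Fintype.sum_prod_type]
  simp only [embed_eq_kronecker, Matrix.submatrix_apply, Equiv.apply_symm_apply,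
    Matrix.kroneckerMap_apply, Matrix.one_apply, mul_ite, mul_one, mul_zero, Finset.sum_ite_eq',
    Finset.mem_univ, ↓reduceIte, splitConfig_symm_apply]
  rfl

theorem extend_apply (h : Z ⊆ Λ) (Φ : Obs q Z →ₗ[ℂ] Obs q Z) (M : Obs q Λ) (σ τ : Config q Λ) :
    extend h Φ M σ τ = Φ (Matrix.of fun a b => M (overrideConfig σ a) (overrideConfig τ b))
      (restrictConfig h σ) (restrictConfig h τ) := rfl

theorem embed_mul_mul_embed_apply (h : Z ⊆ Λ) (B C : Obs q Z) (M : Obs q Λ) (σ τ : Config q Λ) :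
    (embed h B * M * embed h C) σ τ =
      (B * (Matrix.of fun a b => M (overrideConfig σ a) (overrideConfig τ b)) * C : Obs q Z)
        (restrictConfig h σ) (restrictConfig h τ) := by
  rw [mul_embed_apply, Matrix.mul_apply]
  refine Finset.sum_congr rfl fun b _ => ?_
  rw [embed_mul_apply, Matrix.mul_apply]
  rfl

theorem extend_lindbladMap (h : Z ⊆ Λ) {ι : Type*} [Fintype ι] (H : Obs q Z) (K : ι → Obs q Z) :
    extend h (lindbladMap H K) = lindbladMap (embed h H) fun j => embed h (K j) := by
  ext M σ τ
  have hleft (B : Obs q Z) := embed_mul_mul_embed_apply h B 1 M σ τ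
  have hright (B : Obs q Z) := embed_mul_mul_embed_apply h 1 B M σ τ
  simp only [← embedHom_apply, map_one, mul_one, one_mul] at hleft hright
  simp only [extend_apply, lindbladMap_apply, ← embedHom_apply, ← map_star, ← map_mul,
    Matrix.add_apply, Matrix.smul_apply, Matrix.sub_apply, Matrix.sum_apply, hleft, hright]
  simp only [embedHom_apply, embed_mul_mul_embed_apply]

theorem isLindblad_extend (h : Z ⊆ Λ) (hΦ : IsLindblad Φ) : IsLindblad (extend h Φ) := by
  obtain ⟨H, hH, l, K, rfl⟩ := isLindblad_iff.1 hΦ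
  exact isLindblad_iff.2 ⟨embed h H, hH.map (embedHom h), l, _, extend_lindbladMap h H K⟩

theorem extend_mul_right (h : Z ⊆ Λ) (hΦ : IsLindblad Φ) (hN : ∀ B : Obs q Z, Commute (embed h B) N)
    (M : Obs q Λ) : extend h Φ (M * N) = extend h Φ M * N := by
  obtain ⟨H, -, l, K, rfl⟩ := isLindblad_iff.1 hΦ
  rw [extend_lindbladMap]
  refine lindbladMap_mul_right (hN _) (fun _ => hN _) (fun j => ?_) M
  rw [← embedHom_apply, ← map_star]
  exact hN _

theorem extend_mul_left (h : Z ⊆ Λ) (hΦ : IsLindblad Φ) (hN : ∀ B : Obs q Z, Commute (embed h B) N)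
    (M : Obs q Λ) : extend h Φ (N * M) = N * extend h Φ M := by
  obtain ⟨H, -, l, K, rfl⟩ := isLindblad_iff.1 hΦ
  rw [extend_lindbladMap]
  refine lindbladMap_mul_left (hN _) (fun _ => hN _) (fun j => ?_) M
  rw [← embedHom_apply, ← map_star]
  exact hN _

theorem extend_eq_zero (h : Z ⊆ Λ) (hΦ : IsLindblad Φ) (hN : ∀ B : Obs q Z, Commute (embed h B) N) :
    extend h Φ N = 0 := by
  obtain ⟨H, -, l, K, rfl⟩ := isLindblad_iff.1 hΦ
  rw [extend_lindbladMap]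
  refine lindbladMap_eq_zero (hN _) (fun _ => hN _) fun j => ?_
  rw [← embedHom_apply, ← map_star]
  exact hN _

theorem extend_comm (hZ : Z ⊆ Λ) (hW : W ⊆ Λ) (hd : Disjoint Z W) (hΦ : IsLindblad Φ)
    {Ψ : Obs q W →ₗ[ℂ] Obs q W} (hΨ : IsLindblad Ψ) (M : Obs q Λ) :
    extend hZ Φ (extend hW Ψ M) = extend hW Ψ (extend hZ Φ M) := by
  obtain ⟨H, -, l, K, rfl⟩ := isLindblad_iff.1 hΨ
  have hr (B : Obs q W) (P : Obs q Λ) :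
      extend hZ Φ (P * embedHom hW B) = extend hZ Φ P * embedHom hW B :=
    extend_mul_right hZ hΦ (fun C => commute_embed hZ hW hd C B) P
  have hl (B : Obs q W) (P : Obs q Λ) :
      extend hZ Φ (embedHom hW B * P) = embedHom hW B * extend hZ Φ P :=
    extend_mul_left hZ hΦ (fun C => commute_embed hZ hW hd C B) P
  simp only [extend_lindbladMap, lindbladMap_apply, ← embedHom_apply, ← map_star, ← map_mul,
    map_add, map_sum, map_sub, map_smul, hr, hl]

theorem norm_extend_le (h : Z ⊆ Λ) (hΦ : cbNorm Φ < ⊤) (M : Obs q Λ) :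
    ‖extend h Φ M‖ ≤ (cbNorm Φ).toReal * ‖M‖ := by
  let e := (splitConfig h (q := q)).trans
    ((Equiv.refl _).prodCongr (Fintype.equivFin (Config q (Λ \ Z))))
  have he (σ : Config q Λ) (a : Config q Z) : e.symm (a, (e σ).2) = overrideConfig σ a := by
    rw [← splitConfig_symm_apply h]
    simp [e]
  have hext : extend h Φ M = (blockMap _ Φ (M.submatrix e.symm e.symm)).submatrix e e := by
    ext σ τ
    simp only [extend_apply, Matrix.submatrix_apply, blockMap, Matrix.of_apply, he]
    rfl
  calc ‖extend h Φ M‖ ≤ ‖blockMap _ Φ (M.submatrix e.symm e.symm)‖ :=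
        hext ▸ norm_submatrix_equiv_le e _
    _ ≤ (cbNorm Φ).toReal * ‖M.submatrix e.symm e.symm‖ := norm_blockMap_le hΦ _ _
    _ ≤ (cbNorm Φ).toReal * ‖M‖ := by
      gcongr
      exact norm_submatrix_equiv_le e.symm M

/-- The observables in `X`, regarded as a subalgebra of the observables in `Λ`. -/
def localAlgebra (q : Γ → ℕ) (hX : X ⊆ Λ) : StarSubalgebra ℂ (Obs q Λ) :=
  (embedHom hX).range

theorem embed_mem_localAlgebra (hX : X ⊆ Λ) (A : Obs q X) : embed hX A ∈ localAlgebra q hX :=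
  ⟨A, rfl⟩

theorem localAlgebra_mono (hZX : Z ⊆ X) (hX : X ⊆ Λ) :
    localAlgebra q (hZX.trans hX) ≤ localAlgebra q hX := by
  rintro _ ⟨A, rfl⟩
  exact ⟨embed hZX A, embed_embed hZX hX A⟩

theorem commute_embed_of_mem_localAlgebra (hX : X ⊆ Λ) (hZ : Z ⊆ Λ) (hd : Disjoint Z X)
    (hM : M ∈ localAlgebra q hX) (B : Obs q Z) : Commute (embed hZ B) M := by
  obtain ⟨A, rfl⟩ := hM
  exact commute_embed hZ hX hd B A

theorem mul_apply_self_of_mem_localAlgebra (hX : X ⊆ Λ) (hY : Y ⊆ Λ) (hd : Disjoint X Y)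
    (hM : M ∈ localAlgebra q hX) (hN : N ∈ localAlgebra q hY) (σ : Config q Λ) :
    (M * N) σ σ = M σ σ * N σ σ := by
  obtain ⟨A, rfl⟩ := hM
  obtain ⟨B, rfl⟩ := hN
  exact embed_mul_embed_apply_self hX hY hd A B σ

theorem extend_mem_localAlgebra (hX : X ⊆ Λ) (hZX : Z ⊆ X) (hΦ : IsLindblad Φ)
    (hM : M ∈ localAlgebra q hX) : extend (hZX.trans hX) Φ M ∈ localAlgebra q hX := by
  obtain ⟨H, -, l, K, rfl⟩ := isLindblad_iff.1 hΦ
  rw [extend_lindbladMap]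
  exact lindbladMap_mem (localAlgebra_mono hZX hX (embed_mem_localAlgebra _ H))
    (fun j => localAlgebra_mono hZX hX (embed_mem_localAlgebra _ (K j))) hM

end Local

section Volterra

theorem eq_zero_of_le_mul_integral {P : ℝ → ℝ} {K : ℝ} (hPc : Continuous P) (hP : ∀ s, 0 ≤ P s)
    (h : ∀ s, 0 ≤ s → P s ≤ K * ∫ r in (0 : ℝ)..s, P r) {s : ℝ} (hs : 0 ≤ s) : P s = 0 := by
  set Q : ℝ → ℝ := fun s => ∫ r in (0 : ℝ)..s, P r
  have hQd (s : ℝ) : HasDerivAt Q (P s) s := (hPc.integral_hasStrictDerivAt 0 s).hasDerivAt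
  have hQs : Q s = 0 := by
    refine eq_zero_of_abs_deriv_le_mul_abs_self_of_eq_zero_right (f' := P) (K := K)
      (a := 0) (b := s) (fun r _ => (hQd r).continuousAt.continuousWithinAt)
      (fun r _ => (hQd r).hasDerivWithinAt) intervalIntegral.integral_same
      (fun r hr => ?_) s ⟨hs, le_rfl⟩
    rw [Real.norm_of_nonneg (hP r),
      Real.norm_of_nonneg (intervalIntegral.integral_nonneg hr.1 fun r _ => hP r)]
    exact h r hr.1
  refine le_antisymm ?_ (hP s)
  calc P s ≤ K * Q s := h s hs
    _ = 0 := by rw [hQs, mul_zero]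

theorem le_of_volterra_inequality {ι : Type*} (I : Finset ι) {u w : ι → ℝ → ℝ} {b c : ι → ℝ}
    {N : ι → Finset ι} (hN : ∀ i, N i ⊆ I) (hc : ∀ i, 0 ≤ c i) (hu : ∀ i, Continuous (u i))
    (hw : ∀ i, Continuous (w i))
    (hsub : ∀ i ∈ I, ∀ s, 0 ≤ s → u i s ≤ b i + c i * ∫ r in (0 : ℝ)..s, ∑ j ∈ N i, u j r)
    (hsup : ∀ i ∈ I, ∀ s, 0 ≤ s → b i + c i * ∫ r in (0 : ℝ)..s, ∑ j ∈ N i, w j r ≤ w i s)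
    {i : ι} (hi : i ∈ I) {s : ℝ} (hs : 0 ≤ s) : u i s ≤ w i s := by
  set P : ℝ → ℝ := fun s => ∑ j ∈ I, max (u j s - w j s) 0
  have hPc : Continuous P := continuous_finsetSum _ fun j _ =>
    ((hu j).sub (hw j)).max continuous_const
  have hP0 (s : ℝ) : 0 ≤ P s := Finset.sum_nonneg fun j _ => le_max_right _ _
  have hdiff (i : ι) (hi : i ∈ I) (s : ℝ) (hs : 0 ≤ s) :
      u i s - w i s ≤ c i * ∫ r in (0 : ℝ)..s, P r := by
    have huc : Continuous fun r => ∑ j ∈ N i, u j r := continuous_finsetSum _ fun j _ => hu j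
    have hwc : Continuous fun r => ∑ j ∈ N i, w j r := continuous_finsetSum _ fun j _ => hw j
    have hint : (∫ r in (0 : ℝ)..s, ∑ j ∈ N i, u j r) - ∫ r in (0 : ℝ)..s, ∑ j ∈ N i, w j r ≤
        ∫ r in (0 : ℝ)..s, P r := by
      rw [← intervalIntegral.integral_sub (huc.intervalIntegrable _ _)
        (hwc.intervalIntegrable _ _)]
      refine intervalIntegral.integral_mono hs ((huc.sub hwc).intervalIntegrable _ _)
        (hPc.intervalIntegrable _ _) fun r => ?_
      calc ∑ j ∈ N i, u j r - ∑ j ∈ N i, w j r = ∑ j ∈ N i, (u j r - w j r) :=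
            Finset.sum_sub_distrib _ _ |>.symm
        _ ≤ ∑ j ∈ N i, max (u j r - w j r) 0 := Finset.sum_le_sum fun j _ => le_max_left _ _
        _ ≤ P r := Finset.sum_le_sum_of_subset_of_nonneg (hN i) fun j _ _ => le_max_right _ _
    linarith [hsub i hi s hs, hsup i hi s hs, mul_le_mul_of_nonneg_left hint (hc i)]
  have hPs : P s = 0 := by
    refine eq_zero_of_le_mul_integral (K := ∑ j ∈ I, c j) hPc hP0 (fun s hs => ?_) hs
    rw [Finset.sum_mul]
    exact Finset.sum_le_sum fun j hj => max_le (hdiff j hj s hs)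
      (mul_nonneg (hc j) (intervalIntegral.integral_nonneg hs fun r _ => hP0 r))
  have hmax := (Finset.sum_eq_zero_iff_of_nonneg fun j _ => le_max_right _ _).1 hPs i hi
  exact sub_nonpos.1 (max_eq_right_iff.1 hmax)

end Volterra

section Counting

variable {Γ ι : Type*} [DecidableEq Γ] {supp : ι → Finset Γ} {Λ : Finset Γ}

theorem sum_le_sum_sum_filter_mem {K : Finset ι} {Ω : Finset Γ} {a : ι → ℝ} (ha : ∀ i, 0 ≤ a i)
    (hΩ : ∀ i ∈ K, ¬ Disjoint (supp i) Ω) :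
    ∑ i ∈ K, a i ≤ ∑ z ∈ Ω, ∑ i ∈ K with z ∈ supp i, a i := by
  simp only [Finset.sum_filter]
  rw [Finset.sum_comm]
  refine Finset.sum_le_sum fun i hi => ?_
  obtain ⟨z, hz, hzΩ⟩ := Finset.not_disjoint_iff.1 (hΩ i hi)
  calc a i = if z ∈ supp i then a i else 0 := (if_pos hz).symm
    _ ≤ ∑ z ∈ Ω, if z ∈ supp i then a i else 0 :=
      Finset.single_le_sum (f := fun z => if z ∈ supp i then a i else 0)
        (fun _ _ => ite_nonneg (ha i) le_rfl) hzΩ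

theorem sum_filter_mul_sum_supp_le {K : Finset ι} {c : ι → ℝ} {κ φ : Γ → ℝ} {y : Γ}
    (hsupp : ∀ i, supp i ⊆ Λ) (hφ : ∀ z, 0 ≤ φ z)
    (hκ : ∀ z, ∑ i ∈ K with y ∈ supp i ∧ z ∈ supp i, c i ≤ κ z) :
    ∑ i ∈ K with y ∈ supp i, c i * ∑ z ∈ supp i, φ z ≤ ∑ z ∈ Λ, κ z * φ z := by
  calc ∑ i ∈ K with y ∈ supp i, c i * ∑ z ∈ supp i, φ z
      = ∑ i ∈ K with y ∈ supp i, ∑ z ∈ Λ, if z ∈ supp i then c i * φ z else 0 := by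
        refine Finset.sum_congr rfl fun i _ => ?_
        rw [← Finset.sum_filter, Finset.filter_mem_eq_inter, Finset.inter_eq_right.2 (hsupp i),
          Finset.mul_sum]
    _ = ∑ z ∈ Λ, (∑ i ∈ K with y ∈ supp i ∧ z ∈ supp i, c i) * φ z := by
        rw [Finset.sum_comm]
        refine Finset.sum_congr rfl fun z _ => ?_
        rw [← Finset.sum_filter, Finset.filter_filter, Finset.sum_mul]
    _ ≤ ∑ z ∈ Λ, κ z * φ z :=
        Finset.sum_le_sum fun z _ => mul_le_mul_of_nonneg_right (hκ z) (hφ z)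

end Counting

/-! ### Lieb–Robinson bounds -/

section Locality

variable {Γ E ι : Type*} [NormedAddCommGroup E] [NormedSpace ℂ E]

/-- Bounded operators `D i` localized in finite subsets `supp i` of `Λ`, with norms at most `c i`,
such that every partial sum generates a contraction semigroup. -/
structure LocalGenerators (D : ι → E →L[ℂ] E) (supp : ι → Finset Γ) (c : ι → ℝ)
    (Λ : Finset Γ) : Prop where
  nonneg : ∀ i, 0 ≤ c i
  norm_le : ∀ i a, ‖D i a‖ ≤ c i * ‖a‖
  supp_subset : ∀ i, supp i ⊆ Λ
  commute : ∀ i j, Disjoint (supp i) (supp j) → Commute (D i) (D j)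
  contraction : ∀ (J : Finset ι) (s : ℝ) (a : E), 0 ≤ s → ‖flow (∑ j ∈ J, D j) s a‖ ≤ ‖a‖

/-- A nonnegative kernel `k` with `∑_{z ∈ Λ} k(x, z) k(z, y) ≤ C k(x, y)`, as required for a
Lieb–Robinson bound in `Λ`. -/
structure IsConvolutionKernel (k : Γ → Γ → ℝ) (C : ℝ) (Λ : Finset Γ) : Prop where
  nonneg : ∀ x y, 0 ≤ k x y
  pos : 0 < C
  conv_le : ∀ x y, ∑ z ∈ Λ, k x z * k z y ≤ C * k x y

variable {D : ι → E →L[ℂ] E} {supp : ι → Finset Γ} {c : ι → ℝ} {Λ X Ω : Finset Γ}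
  {J K : Finset ι} {a : E} {s t : ℝ}

theorem LocalGenerators.apply_flow_eq_zero (hD : LocalGenerators D supp c Λ) {i : ι}
    (hJ : ∀ j ∈ J, Disjoint (supp i) (supp j)) (ha : D i a = 0) (s : ℝ) :
    D i (flow (∑ j ∈ J, D j) s a) = 0 := by
  have hcomm : Commute (D i) (∑ j ∈ J, D j) :=
    Commute.sum_right _ _ _ fun j hj => hD.commute i j (hJ j hj)
  calc D i (flow (∑ j ∈ J, D j) s a) = flow (∑ j ∈ J, D j) s (D i a) :=
        DFunLike.congr_fun (commute_flow hcomm s).eq a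
    _ = 0 := by rw [ha, map_zero]

/-- This is Duhamel's formula for the removal of the generators in `K \ J`. -/
theorem LocalGenerators.norm_flow_sub_flow_le [DecidableEq ι] [CompleteSpace E]
    (hD : LocalGenerators D supp c Λ) (hJK : J ⊆ K) {b : ℝ} (ht : 0 ≤ t)
    (hb : ∀ s ∈ Set.Icc 0 t, ∑ i ∈ K \ J, ‖D i (flow (∑ j ∈ J, D j) s a)‖ ≤ b) :
    ‖flow (∑ j ∈ K, D j) t a - flow (∑ j ∈ J, D j) t a‖ ≤ b * t := by
  set G := ∑ j ∈ K, D j with hG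
  set G' := ∑ j ∈ J, D j with hG'
  set f : ℝ → E := fun s => flow G (t - s) (flow G' s a) with hf
  have hd (s : ℝ) : HasDerivAt f (flow G (t - s) (G' (flow G' s a) - G (flow G' s a))) s :=
    hasDerivAt_flow_sub_apply G (hasDerivAt_flow_apply G' a s)
  have hsplit (x : E) : G x - G' x = ∑ i ∈ K \ J, D i x := by
    rw [hG, hG', ← Finset.sum_sdiff hJK, add_apply, add_sub_cancel_right, sum_apply]
  have hbound (s : ℝ) (hs : s ∈ Set.Ico 0 t) :
      ‖flow G (t - s) (G' (flow G' s a) - G (flow G' s a))‖ ≤ b := by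
    refine (hD.contraction _ _ _ (sub_nonneg.2 hs.2.le)).trans ?_
    rw [norm_sub_rev, hsplit]
    exact (norm_sum_le _ _).trans (hb s ⟨hs.1, hs.2.le⟩)
  have hmvt := norm_image_sub_le_of_norm_deriv_le_segment'
    (fun s _ => (hd s).hasDerivWithinAt) hbound t (Set.right_mem_Icc.2 ht)
  rw [norm_sub_rev]
  simpa only [hf, sub_self, sub_zero, flow_zero, one_apply_eq_self] using hmvt

variable [DecidableEq Γ]

theorem LocalGenerators.sum_norm_apply_flow_le_of_subset
    (hD : LocalGenerators D supp c Λ) (hXΩ : X ⊆ Ω) (hJΩ : ∀ j ∈ J, supp j ⊆ Ω)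
    (ha : ∀ i, Disjoint (supp i) X → D i a = 0) (hs : 0 ≤ s) :
    ∑ i ∈ K, ‖D i (flow (∑ j ∈ J, D j) s a)‖ ≤
      ‖a‖ * ∑ z ∈ Ω, ∑ i ∈ K with z ∈ supp i, c i := by
  have hzero (i : ι) (hi : Disjoint (supp i) Ω) : D i (flow (∑ j ∈ J, D j) s a) = 0 :=
    hD.apply_flow_eq_zero (fun j hj => hi.mono_right (hJΩ j hj)) (ha i (hi.mono_right hXΩ)) s
  have hfilter : ∑ i ∈ K with ¬ Disjoint (supp i) Ω, ‖D i (flow (∑ j ∈ J, D j) s a)‖ =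
      ∑ i ∈ K, ‖D i (flow (∑ j ∈ J, D j) s a)‖ :=
    Finset.sum_filter_of_ne fun i _ hne hi => hne (by rw [hzero i hi, norm_zero])
  calc ∑ i ∈ K, ‖D i (flow (∑ j ∈ J, D j) s a)‖
      = ∑ i ∈ K with ¬ Disjoint (supp i) Ω, ‖D i (flow (∑ j ∈ J, D j) s a)‖ := hfilter.symm
    _ ≤ ∑ i ∈ K with ¬ Disjoint (supp i) Ω, c i * ‖a‖ := Finset.sum_le_sum fun i _ =>
        (hD.norm_le i _).trans (mul_le_mul_of_nonneg_left (hD.contraction J s a hs) (hD.nonneg i))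
    _ = ‖a‖ * ∑ i ∈ K with ¬ Disjoint (supp i) Ω, c i := by rw [← Finset.sum_mul, mul_comm]
    _ ≤ ‖a‖ * ∑ z ∈ Ω, ∑ i ∈ K with z ∈ supp i, c i := by
        refine mul_le_mul_of_nonneg_left ((sum_le_sum_sum_filter_mem hD.nonneg fun i hi =>
          (Finset.mem_filter.1 hi).2).trans (Finset.sum_le_sum fun z _ => ?_)) (norm_nonneg a)
        exact Finset.sum_le_sum_of_subset_of_nonneg
          (Finset.filter_subset_filter _ (Finset.filter_subset _ _)) fun i _ _ => hD.nonneg i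

/-- The Lieb–Robinson bound, at the site `z` and the time `s`, for the effect of what starts at the
site `x`, when the interactions are bounded by `m` times the kernel `k`. -/
def lrProfile (k : Γ → Γ → ℝ) (m C : ℝ) (x z : Γ) (s : ℝ) : ℝ :=
  (if x = z then 1 else 0) + C⁻¹ * k z x * (Real.exp (m * C * s) - 1)

variable {k : Γ → Γ → ℝ} {m C : ℝ}

theorem IsConvolutionKernel.lrProfile_nonneg (hk : IsConvolutionKernel k C Λ) (hm : 0 ≤ m)
    (x z : Γ) (hs : 0 ≤ s) : 0 ≤ lrProfile k m C x z s := by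
  have hC := hk.pos
  have hkzx := hk.nonneg z x
  have hexp : 0 ≤ Real.exp (m * C * s) - 1 := sub_nonneg.2 (Real.one_le_exp (by positivity))
  unfold lrProfile
  positivity

theorem hasDerivAt_lrProfile (k : Γ → Γ → ℝ) (m : ℝ) (hC : C ≠ 0) (x z : Γ) (s : ℝ) :
    HasDerivAt (lrProfile k m C x z) (m * k z x * Real.exp (m * C * s)) s := by
  have hexp : HasDerivAt (fun s => Real.exp (m * C * s)) (Real.exp (m * C * s) * (m * C)) s := by
    simpa only [id, mul_one] using ((hasDerivAt_id s).const_mul (m * C)).exp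
  convert! ((hexp.sub_const 1).const_mul (C⁻¹ * k z x)).const_add (if x = z then (1 : ℝ) else 0)
    using 1
  field_simp

theorem IsConvolutionKernel.sum_mul_lrProfile_le (hk : IsConvolutionKernel k C Λ) (hm : 0 ≤ m)
    {x : Γ} (hx : x ∈ Λ) (y : Γ) (hs : 0 ≤ s) :
    ∑ z ∈ Λ, m * k y z * lrProfile k m C x z s ≤ m * k y x * Real.exp (m * C * s) := by
  have hC := hk.pos
  have hexp : 0 ≤ Real.exp (m * C * s) - 1 := sub_nonneg.2 (Real.one_le_exp (by positivity))
  calc ∑ z ∈ Λ, m * k y z * lrProfile k m C x z s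
      = m * k y x + m * C⁻¹ * (Real.exp (m * C * s) - 1) * ∑ z ∈ Λ, k y z * k z x := by
        simp only [lrProfile, mul_add, Finset.sum_add_distrib, mul_ite, mul_one, mul_zero,
          Finset.sum_ite_eq, hx, if_true, Finset.mul_sum]
        congr 1
        exact Finset.sum_congr rfl fun z _ => by ring
    _ ≤ m * k y x + m * C⁻¹ * (Real.exp (m * C * s) - 1) * (C * k y x) := by
        gcongr
        exact hk.conv_le y x
    _ = m * k y x * Real.exp (m * C * s) := by
        field_simp
        ring

theorem LocalGenerators.norm_apply_le_sum_lrProfile (hD : LocalGenerators D supp c Λ)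
    (hk : IsConvolutionKernel k C Λ) (hm : 0 ≤ m) {i : ι}
    (ha : Disjoint (supp i) X → D i a = 0) :
    ‖D i a‖ ≤ ‖a‖ * (c i * ∑ z ∈ supp i, ∑ x ∈ X, lrProfile k m C x z 0) := by
  have hprofile (x z : Γ) : 0 ≤ lrProfile k m C x z 0 := hk.lrProfile_nonneg hm x z le_rfl
  have hsum (z : Γ) : 0 ≤ ∑ x ∈ X, lrProfile k m C x z 0 :=
    Finset.sum_nonneg fun x _ => hprofile x z
  by_cases hd : Disjoint (supp i) X
  · rw [ha hd, norm_zero]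
    exact mul_nonneg (norm_nonneg a)
      (mul_nonneg (hD.nonneg i) (Finset.sum_nonneg fun z _ => hsum z))
  · obtain ⟨z, hz, hzX⟩ := Finset.not_disjoint_iff.1 hd
    have hone : 1 ≤ ∑ z ∈ supp i, ∑ x ∈ X, lrProfile k m C x z 0 :=
      calc (1 : ℝ) = lrProfile k m C z z 0 := by simp [lrProfile]
        _ ≤ ∑ x ∈ X, lrProfile k m C x z 0 :=
          Finset.single_le_sum (f := fun x => lrProfile k m C x z 0)
            (fun x _ => hprofile x z) hzX
        _ ≤ ∑ z ∈ supp i, ∑ x ∈ X, lrProfile k m C x z 0 :=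
          Finset.single_le_sum (fun w _ => hsum w) hz
    calc ‖D i a‖ ≤ ‖a‖ * c i := (hD.norm_le i a).trans_eq (mul_comm _ _)
      _ ≤ ‖a‖ * (c i * ∑ z ∈ supp i, ∑ x ∈ X, lrProfile k m C x z 0) :=
        mul_le_mul_of_nonneg_left (le_mul_of_one_le_right (hD.nonneg i) hone) (norm_nonneg a)

theorem LocalGenerators.sum_mul_sum_lrProfile_le (hD : LocalGenerators D supp c Λ)
    (hk : IsConvolutionKernel k C Λ) (hm : 0 ≤ m)
    (hKk : ∀ y z, ∑ j ∈ K with y ∈ supp j ∧ z ∈ supp j, c j ≤ m * k y z) {x : Γ} (hx : x ∈ Λ)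
    (hKΩ : ∀ j ∈ K, ¬ Disjoint (supp j) Ω) (hs : 0 ≤ s) :
    ∑ j ∈ K, c j * ∑ z ∈ supp j, lrProfile k m C x z s ≤
      ∑ y ∈ Ω, m * k y x * Real.exp (m * C * s) := by
  have hprofile (z : Γ) : 0 ≤ lrProfile k m C x z s := hk.lrProfile_nonneg hm x z hs
  calc ∑ j ∈ K, c j * ∑ z ∈ supp j, lrProfile k m C x z s
      ≤ ∑ y ∈ Ω, ∑ j ∈ K with y ∈ supp j, c j * ∑ z ∈ supp j, lrProfile k m C x z s :=
        sum_le_sum_sum_filter_mem (fun j => mul_nonneg (hD.nonneg j)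
          (Finset.sum_nonneg fun z _ => hprofile z)) hKΩ
    _ ≤ ∑ y ∈ Ω, ∑ z ∈ Λ, m * k y z * lrProfile k m C x z s := Finset.sum_le_sum fun y _ =>
        sum_filter_mul_sum_supp_le hD.supp_subset hprofile (hKk y)
    _ ≤ ∑ y ∈ Ω, m * k y x * Real.exp (m * C * s) := Finset.sum_le_sum fun y _ =>
        hk.sum_mul_lrProfile_le hm hx y hs

theorem LocalGenerators.integral_sum_lrProfile_le (hD : LocalGenerators D supp c Λ)
    (hk : IsConvolutionKernel k C Λ) (hm : 0 ≤ m)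
    (hJk : ∀ y z, ∑ j ∈ J with y ∈ supp j ∧ z ∈ supp j, c j ≤ m * k y z) (hX : X ⊆ Λ) (i : ι)
    (hs : 0 ≤ s) :
    ∫ r in (0 : ℝ)..s, ∑ j ∈ J with ¬ Disjoint (supp i) (supp j),
        c j * ∑ z ∈ supp j, ∑ x ∈ X, lrProfile k m C x z r ≤
      ∑ z ∈ supp i, ∑ x ∈ X, lrProfile k m C x z s -
        ∑ z ∈ supp i, ∑ x ∈ X, lrProfile k m C x z 0 := by
  have hderiv (r : ℝ) : HasDerivAt (fun r => ∑ z ∈ supp i, ∑ x ∈ X, lrProfile k m C x z r)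
      (∑ z ∈ supp i, ∑ x ∈ X, m * k z x * Real.exp (m * C * r)) r :=
    HasDerivAt.fun_sum fun z _ => HasDerivAt.fun_sum fun x _ =>
      hasDerivAt_lrProfile k m hk.pos.ne' x z r
  have hprofile (x z : Γ) : Continuous (lrProfile k m C x z) :=
    continuous_iff_continuousAt.2 fun r => (hasDerivAt_lrProfile k m hk.pos.ne' x z r).continuousAt
  have hcont : Continuous fun r => ∑ j ∈ J with ¬ Disjoint (supp i) (supp j),
      c j * ∑ z ∈ supp j, ∑ x ∈ X, lrProfile k m C x z r := by
    fun_prop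
  refine intervalIntegral.integral_le_sub_of_hasDeriv_right_of_le hs
    (fun r _ => (hderiv r).continuousAt.continuousWithinAt) (fun r _ => (hderiv r).hasDerivWithinAt)
    (hcont.continuousOn.integrableOn_Icc) fun r hr => ?_
  have hJi (y z : Γ) : ∑ j ∈ {j ∈ J | ¬ Disjoint (supp i) (supp j)} with
      y ∈ supp j ∧ z ∈ supp j, c j ≤ m * k y z :=
    (Finset.sum_le_sum_of_subset_of_nonneg
      (Finset.filter_subset_filter _ (Finset.filter_subset _ _)) fun j _ _ => hD.nonneg j).trans
      (hJk y z)
  calc ∑ j ∈ J with ¬ Disjoint (supp i) (supp j),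
        c j * ∑ z ∈ supp j, ∑ x ∈ X, lrProfile k m C x z r
      = ∑ x ∈ X, ∑ j ∈ J with ¬ Disjoint (supp i) (supp j),
          c j * ∑ z ∈ supp j, lrProfile k m C x z r := by
        rw [Finset.sum_comm]
        refine Finset.sum_congr rfl fun j _ => ?_
        rw [Finset.sum_comm, Finset.mul_sum]
    _ ≤ ∑ x ∈ X, ∑ z ∈ supp i, m * k z x * Real.exp (m * C * r) :=
        Finset.sum_le_sum fun x hx => hD.sum_mul_sum_lrProfile_le hk hm hJi (hX hx)
          (fun j hj hd => (Finset.mem_filter.1 hj).2 hd.symm) hr.1.le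
    _ = ∑ z ∈ supp i, ∑ x ∈ X, m * k z x * Real.exp (m * C * r) := Finset.sum_comm

variable [CompleteSpace E]

theorem LocalGenerators.norm_apply_flow_le_integral (hD : LocalGenerators D supp c Λ)
    (J : Finset ι) (i : ι) (a : E) (ht : 0 ≤ t) :
    ‖D i (flow (∑ j ∈ J, D j) t a)‖ ≤ ‖D i a‖ + c i * ∫ s in (0 : ℝ)..t,
      ∑ j ∈ J with ¬ Disjoint (supp i) (supp j), ‖D j (flow (∑ j ∈ J, D j) s a)‖ := by
  set G := ∑ j ∈ J, D j with hG
  set G' := ∑ j ∈ J with Disjoint (supp i) (supp j), D j with hG'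
  set f : ℝ → E := fun s => flow G' (t - s) (D i (flow G s a)) with hf
  set u : ℝ → ℝ := fun s => ∑ j ∈ J with ¬ Disjoint (supp i) (supp j), ‖D j (flow G s a)‖
  have hcomm (x : E) : G' (D i x) = D i (G' x) :=
    DFunLike.congr_fun (Commute.sum_left _ _ _ fun j hj =>
      (hD.commute i j (Finset.mem_filter.1 hj).2).symm).eq x
  have hsplit (x : E) :
      G x = G' x + ∑ j ∈ J with ¬ Disjoint (supp i) (supp j), D j x := by
    rw [hG, hG', ← sum_apply, ← add_apply, Finset.sum_filter_add_sum_filter_not]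
  have hd (s : ℝ) : HasDerivAt f (flow G' (t - s) (D i
      (∑ j ∈ J with ¬ Disjoint (supp i) (supp j), D j (flow G s a)))) s := by
    have hDflow : HasDerivAt (fun s => D i (flow G s a)) (D i (G (flow G s a))) s :=
      ((D i).restrictScalars ℝ).hasFDerivAt.comp_hasDerivAt s (hasDerivAt_flow_apply G a s)
    have h := hasDerivAt_flow_sub_apply G' (t := t) hDflow
    rwa [hcomm, hsplit, map_add, add_sub_cancel_left] at h
  have hbound (s : ℝ) (hs : s ∈ Set.Ico 0 t) : ‖flow G' (t - s) (D i
      (∑ j ∈ J with ¬ Disjoint (supp i) (supp j), D j (flow G s a)))‖ ≤ c i * u s :=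
    (hD.contraction _ _ _ (sub_nonneg.2 hs.2.le)).trans <| (hD.norm_le _ _).trans <|
      mul_le_mul_of_nonneg_left (norm_sum_le _ _) (hD.nonneg i)
  have huc : Continuous u :=
    continuous_finsetSum _ fun j _ => ((D j).continuous.comp (continuous_flow_apply G a)).norm
  have hB (s : ℝ) : HasDerivAt (fun s => ‖D i a‖ + c i * ∫ r in (0 : ℝ)..s, u r) (c i * u s) s :=
    ((huc.integral_hasStrictDerivAt 0 s).hasDerivAt.const_mul _).const_add _
  have hf0 : ‖f 0‖ ≤ ‖D i a‖ + c i * ∫ r in (0 : ℝ)..0, u r := by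
    simpa only [hf, sub_zero, flow_zero, one_apply_eq_self,
      intervalIntegral.integral_same, mul_zero, add_zero] using hD.contraction _ t (D i a) ht
  have hft := image_norm_le_of_norm_deriv_right_le_deriv_boundary'
    (fun s _ => (hd s).continuousAt.continuousWithinAt) (fun s _ => (hd s).hasDerivWithinAt)
    hf0 (fun s _ => (hB s).continuousAt.continuousWithinAt)
    (fun s _ => (hB s).hasDerivWithinAt) hbound (Set.right_mem_Icc.2 ht)
  simpa only [hf, sub_self, flow_zero, one_apply_eq_self] using hft

/-- The Lieb–Robinson bound: the profile is a supersolution of the Volterra system satisfied by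
the norms `‖D i (flow (∑ j ∈ J, D j) s a)‖`. -/
theorem LocalGenerators.norm_apply_flow_le_lrProfile (hD : LocalGenerators D supp c Λ)
    (hk : IsConvolutionKernel k C Λ) (hm : 0 ≤ m)
    (hJk : ∀ y z, ∑ j ∈ J with y ∈ supp j ∧ z ∈ supp j, c j ≤ m * k y z) (hX : X ⊆ Λ)
    (ha : ∀ i, Disjoint (supp i) X → D i a = 0) (i : ι) (hs : 0 ≤ s) :
    ‖D i (flow (∑ j ∈ J, D j) s a)‖ ≤
      ‖a‖ * (c i * ∑ z ∈ supp i, ∑ x ∈ X, lrProfile k m C x z s) := by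
  classical
  have hprofile (x z : Γ) : Continuous (lrProfile k m C x z) :=
    continuous_iff_continuousAt.2 fun r => (hasDerivAt_lrProfile k m hk.pos.ne' x z r).continuousAt
  refine le_of_volterra_inequality (insert i J)
    (u := fun i s => ‖D i (flow (∑ j ∈ J, D j) s a)‖)
    (w := fun i s => ‖a‖ * (c i * ∑ z ∈ supp i, ∑ x ∈ X, lrProfile k m C x z s))
    (b := fun i => ‖D i a‖) (N := fun i => {j ∈ J | ¬ Disjoint (supp i) (supp j)})
    (fun i => (Finset.filter_subset _ _).trans (Finset.subset_insert _ _)) hD.nonneg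
    (fun i => ((D i).continuous.comp (continuous_flow_apply _ a)).norm) (fun i => by fun_prop)
    (fun i _ s hs => hD.norm_apply_flow_le_integral J i a hs) (fun i _ s hs => ?_)
    (Finset.mem_insert_self i J) hs
  simp only [← Finset.mul_sum, intervalIntegral.integral_const_mul]
  have hinitial := hD.norm_apply_le_sum_lrProfile hk hm (ha i)
  have hintegral := mul_le_mul_of_nonneg_left (hD.integral_sum_lrProfile_le hk hm hJk hX i hs)
    (mul_nonneg (norm_nonneg a) (hD.nonneg i))
  linarith

theorem LocalGenerators.sum_norm_apply_flow_le (hD : LocalGenerators D supp c Λ)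
    (hk : IsConvolutionKernel k C Λ) (hm : 0 ≤ m)
    (hJk : ∀ y z, ∑ j ∈ J with y ∈ supp j ∧ z ∈ supp j, c j ≤ m * k y z)
    (hKk : ∀ y z, ∑ j ∈ K with y ∈ supp j ∧ z ∈ supp j, c j ≤ m * k y z) (hX : X ⊆ Λ)
    (ha : ∀ i, Disjoint (supp i) X → D i a = 0) {far : Γ → Finset Γ}
    (hfar : ∀ x ∈ X, ∀ i ∈ K, ¬ Disjoint (supp i) (far x)) (hs : 0 ≤ s) :
    ∑ i ∈ K, ‖D i (flow (∑ j ∈ J, D j) s a)‖ ≤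
      ‖a‖ * m * Real.exp (m * C * s) * ∑ x ∈ X, ∑ y ∈ far x, k y x := by
  calc ∑ i ∈ K, ‖D i (flow (∑ j ∈ J, D j) s a)‖
      ≤ ∑ i ∈ K, ‖a‖ * (c i * ∑ z ∈ supp i, ∑ x ∈ X, lrProfile k m C x z s) :=
        Finset.sum_le_sum fun i _ => hD.norm_apply_flow_le_lrProfile hk hm hJk hX ha i hs
    _ = ‖a‖ * ∑ x ∈ X, ∑ i ∈ K, c i * ∑ z ∈ supp i, lrProfile k m C x z s := by
        rw [Finset.sum_comm, Finset.mul_sum]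
        refine Finset.sum_congr rfl fun i _ => ?_
        rw [Finset.sum_comm, ← Finset.mul_sum]
    _ ≤ ‖a‖ * ∑ x ∈ X, ∑ y ∈ far x, m * k y x * Real.exp (m * C * s) :=
        mul_le_mul_of_nonneg_left (Finset.sum_le_sum fun x hx =>
          hD.sum_mul_sum_lrProfile_le hk hm hKk (hX hx) (hfar x hx) hs) (norm_nonneg a)
    _ = ‖a‖ * m * Real.exp (m * C * s) * ∑ x ∈ X, ∑ y ∈ far x, k y x := by
        simp only [Finset.mul_sum]
        exact Finset.sum_congr rfl fun x _ => Finset.sum_congr rfl fun y _ => by ring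

end Locality

/-! ### Decay functions on regular spaces -/

theorem le_sInf_mul {ι κ : Type*} {f g : ι → κ → ℝ≥0∞} (hg0 : ∀ i j, g i j ≠ 0)
    (hg : ∀ i j, g i j ≠ ⊤) (i : ι) (j : κ) :
    f i j ≤ sInf {C | ∀ i j, f i j ≤ C * g i j} * g i j := by
  rw [← ENNReal.div_le_iff (hg0 i j) (hg i j)]
  exact le_sInf fun C hC => (ENNReal.div_le_iff (hg0 i j) (hg i j)).2 (hC i j)

section Decay

variable {Γ : Type*} [MetricSpace Γ] {F : ℝ → ℝ}

theorem ofReal_zero_le_convConst [Nonempty Γ] (hF : 0 < F 0) :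
    ENNReal.ofReal (F 0) ≤ convConst Γ F := by
  refine le_sInf fun C hC => ?_
  let x : Γ := Classical.arbitrary Γ
  have hF0 : ENNReal.ofReal (F 0) ≠ 0 := (ENNReal.ofReal_pos.2 hF).ne'
  refine (ENNReal.mul_le_mul_iff_left hF0 ENNReal.ofReal_ne_top).1 ?_
  simpa only [dist_self] using (ENNReal.le_tsum x).trans (hC x x)

theorem tsum_mul_le_convConst (hF : ∀ r, 0 ≤ r → 0 < F r) (x y : Γ) :
    ∑' z : Γ, ENNReal.ofReal (F (dist x z)) * ENNReal.ofReal (F (dist z y)) ≤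
      convConst Γ F * ENNReal.ofReal (F (dist x y)) :=
  le_sInf_mul (g := fun x y : Γ => ENNReal.ofReal (F (dist x y)))
    (fun _ _ => (ENNReal.ofReal_pos.2 (hF _ dist_nonneg)).ne') (fun _ _ => ENNReal.ofReal_ne_top)
    x y

theorem sum_mul_le_convConst (hF : ∀ r, 0 ≤ r → 0 < F r) (hC : convConst Γ F < ⊤)
    (s : Finset Γ) (x y : Γ) :
    ∑ z ∈ s, F (dist x z) * F (dist z y) ≤ (convConst Γ F).toReal * F (dist x y) := by
  have hF0 (u v : Γ) : 0 ≤ F (dist u v) := (hF _ dist_nonneg).le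
  rw [← ENNReal.ofReal_le_ofReal_iff (mul_nonneg ENNReal.toReal_nonneg (hF0 x y)),
    ENNReal.ofReal_mul ENNReal.toReal_nonneg, ENNReal.ofReal_toReal hC.ne,
    ENNReal.ofReal_sum_of_nonneg fun z _ => mul_nonneg (hF0 x z) (hF0 z y)]
  simp only [ENNReal.ofReal_mul (hF0 _ _)]
  exact (ENNReal.sum_le_tsum s).trans (tsum_mul_le_convConst hF x y)

/-- The decay function `F` with an additional exponential factor of range `R`, which bounds
interactions of range `R` up to the factor `e`. -/
def truncatedKernel (F : ℝ → ℝ) (R : ℝ) (x y : Γ) : ℝ := F (dist x y) * Real.exp (-(dist x y / R))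

theorem isConvolutionKernel_truncatedKernel [Nonempty Γ] (hF : ∀ r, 0 ≤ r → 0 < F r)
    (hC : convConst Γ F < ⊤) {R : ℝ} (hR : 0 ≤ R) (Λ : Finset Γ) :
    IsConvolutionKernel (truncatedKernel F R) (convConst Γ F).toReal Λ where
  nonneg x y := mul_nonneg (hF _ dist_nonneg).le (Real.exp_pos _).le
  pos := ENNReal.toReal_pos ((ENNReal.ofReal_pos.2 (hF 0 le_rfl)).trans_le
    (ofReal_zero_le_convConst (hF 0 le_rfl))).ne' hC.ne
  conv_le x y := by
    have hexp (z : Γ) : Real.exp (-(dist x z / R)) * Real.exp (-(dist z y / R)) ≤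
        Real.exp (-(dist x y / R)) := by
      rw [← Real.exp_add, Real.exp_le_exp, ← neg_add, ← add_div, neg_le_neg_iff]
      exact div_le_div_of_nonneg_right (dist_triangle x z y) hR
    calc ∑ z ∈ Λ, truncatedKernel F R x z * truncatedKernel F R z y
        ≤ ∑ z ∈ Λ, F (dist x z) * F (dist z y) * Real.exp (-(dist x y / R)) := by
          refine Finset.sum_le_sum fun z _ => ?_
          rw [truncatedKernel, truncatedKernel, mul_mul_mul_comm]
          exact mul_le_mul_of_nonneg_left (hexp z)
            (mul_nonneg (hF _ dist_nonneg).le (hF _ dist_nonneg).le)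
      _ ≤ (convConst Γ F).toReal * F (dist x y) * Real.exp (-(dist x y / R)) := by
          rw [← Finset.sum_mul]
          exact mul_le_mul_of_nonneg_right (sum_mul_le_convConst hF hC Λ x y) (Real.exp_pos _).le
      _ = (convConst Γ F).toReal * truncatedKernel F R x y := by rw [truncatedKernel, mul_assoc]

variable [DecidableEq Γ] {q : Γ → ℕ} {L : DissipativeInteraction q}

theorem tsum_cbNorm_le (hF : ∀ r, 0 ≤ r → 0 < F r) (L : DissipativeInteraction q) (x y : Γ) :
    ∑' Z : {Z : Finset Γ // x ∈ Z ∧ y ∈ Z}, cbNorm (L.map Z.1) ≤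
      interactionNorm F L * ENNReal.ofReal (F (dist x y)) :=
  le_sInf_mul (g := fun x y : Γ => ENNReal.ofReal (F (dist x y)))
    (fun _ _ => (ENNReal.ofReal_pos.2 (hF _ dist_nonneg)).ne') (fun _ _ => ENNReal.ofReal_ne_top)
    x y

theorem cbNorm_lt_top (hF : ∀ r, 0 ≤ r → 0 < F r) (hL : interactionNorm F L < ⊤)
    {Z : Finset Γ} (hZ : Z.Nonempty) : cbNorm (L.map Z) < ⊤ := by
  obtain ⟨x, hx⟩ := hZ
  calc cbNorm (L.map Z)
      ≤ ∑' Z : {Z : Finset Γ // x ∈ Z ∧ x ∈ Z}, cbNorm (L.map Z.1) :=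
        ENNReal.le_tsum (f := fun Z : {Z : Finset Γ // x ∈ Z ∧ x ∈ Z} => cbNorm (L.map Z.1))
          ⟨Z, hx, hx⟩
    _ ≤ interactionNorm F L * ENNReal.ofReal (F (dist x x)) := tsum_cbNorm_le hF L x x
    _ < ⊤ := ENNReal.mul_lt_top hL ENNReal.ofReal_lt_top

theorem sum_cbNorm_le (hF : ∀ r, 0 ≤ r → 0 < F r) (hL : interactionNorm F L < ⊤) {ι : Type*}
    (I : Finset ι) {supp : ι → Finset Γ} (hsupp : Function.Injective supp) (x y : Γ) :
    ∑ i ∈ I with x ∈ supp i ∧ y ∈ supp i, (cbNorm (L.map (supp i))).toReal ≤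
      (interactionNorm F L).toReal * F (dist x y) := by
  set K := {i ∈ I | x ∈ supp i ∧ y ∈ supp i}
  have hK (i : K) : x ∈ supp i ∧ y ∈ supp i := (Finset.mem_filter.1 i.2).2
  have hinj : Function.Injective fun i : K =>
      (⟨supp i, hK i⟩ : {Z : Finset Γ // x ∈ Z ∧ y ∈ Z}) := fun i j hij =>
    Subtype.ext (hsupp (congrArg Subtype.val hij))
  have hFxy : 0 ≤ F (dist x y) := (hF _ dist_nonneg).le
  rw [← ENNReal.ofReal_le_ofReal_iff (mul_nonneg ENNReal.toReal_nonneg hFxy),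
    ENNReal.ofReal_mul ENNReal.toReal_nonneg, ENNReal.ofReal_toReal hL.ne,
    ENNReal.ofReal_sum_of_nonneg fun i _ => ENNReal.toReal_nonneg]
  calc ∑ i ∈ K, ENNReal.ofReal (cbNorm (L.map (supp i))).toReal
      = ∑ i : K, cbNorm (L.map (supp i)) := by
        rw [← Finset.sum_coe_sort]
        exact Finset.sum_congr rfl fun i _ =>
          ENNReal.ofReal_toReal (cbNorm_lt_top hF hL ⟨x, (hK i).1⟩).ne
    _ = ∑' i : K, cbNorm (L.map (supp i)) := (tsum_fintype _).symm
    _ ≤ ∑' Z : {Z : Finset Γ // x ∈ Z ∧ y ∈ Z}, cbNorm (L.map Z.1) :=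
        ENNReal.tsum_comp_le_tsum_of_injective hinj
          fun Z : {Z : Finset Γ // x ∈ Z ∧ y ∈ Z} => cbNorm (L.map Z.1)
    _ ≤ interactionNorm F L * ENNReal.ofReal (F (dist x y)) := tsum_cbNorm_le hF L x y

theorem sum_cbNorm_le_truncatedKernel (hF : ∀ r, 0 ≤ r → 0 < F r)
    (hL : interactionNorm F L < ⊤) {ι : Type*} {I : Finset ι} {supp : ι → Finset Γ}
    (hsupp : Function.Injective supp) {R : ℝ} (hR : 0 < R)
    (hI : ∀ i ∈ I, ∀ y ∈ supp i, ∀ z ∈ supp i, dist y z ≤ R) (x y : Γ) :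
    ∑ i ∈ I with x ∈ supp i ∧ y ∈ supp i, (cbNorm (L.map (supp i))).toReal ≤
      (interactionNorm F L).toReal * Real.exp 1 * truncatedKernel F R x y := by
  have hF0 : 0 ≤ (interactionNorm F L).toReal * F (dist x y) :=
    mul_nonneg ENNReal.toReal_nonneg (hF _ dist_nonneg).le
  have hkernel : (interactionNorm F L).toReal * Real.exp 1 * truncatedKernel F R x y =
      (interactionNorm F L).toReal * F (dist x y) *
        (Real.exp 1 * Real.exp (-(dist x y / R))) := by
    rw [truncatedKernel]
    ring
  rw [hkernel]
  rcases Finset.eq_empty_or_nonempty {i ∈ I | x ∈ supp i ∧ y ∈ supp i} with h | ⟨i, hi⟩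
  · rw [h, Finset.sum_empty]
    positivity
  · obtain ⟨hiI, hx, hy⟩ := Finset.mem_filter.1 hi
    have hexp : 1 ≤ Real.exp 1 * Real.exp (-(dist x y / R)) := by
      rw [← Real.exp_add]
      refine Real.one_le_exp ?_
      rw [← sub_eq_add_neg, sub_nonneg, div_le_one hR]
      exact hI i hiI x hx y hy
    exact (sum_cbNorm_le hF hL I hsupp x y).trans (le_mul_of_one_le_right hF0 hexp)

end Decay

section PowerLaw

variable {Γ : Type*} [MetricSpace Γ] {κ ν α ε : ℝ}

theorem powerLaw_pos (α r : ℝ) (hr : 0 ≤ r) : 0 < powerLaw α r := by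
  unfold powerLaw
  positivity

theorem powerLaw_eq_rpow_neg (α : ℝ) {r : ℝ} (hr : 0 ≤ r) : powerLaw α r = (1 + r) ^ (-α) := by
  rw [powerLaw, Real.rpow_neg (by positivity), one_div]

theorem summable_zetaConst (hε : 0 < ε) : Summable fun n : ℕ => 1 / (1 + (n : ℝ)) ^ (1 + ε) := by
  simpa only [Nat.cast_add, Nat.cast_one, add_comm] using
    (summable_nat_add_iff 1).2 (Real.summable_one_div_nat_rpow.2 (lt_add_of_pos_right 1 hε))

theorem zetaConst_nonneg (ε : ℝ) : 0 ≤ zetaConst ε :=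
  tsum_nonneg fun n => by positivity

theorem IsRegularSpace.card_le (hΓ : IsRegularSpace Γ κ ν) (s : Finset Γ) (x : Γ) (n : ℕ)
    (hs : ∀ y ∈ s, dist x y ≤ (n : ℝ) + 1) : (s.card : ℝ) ≤ κ * ((n : ℝ) + 1) ^ ν := by
  refine le_trans ?_ (hΓ.ball_card x n)
  rw [← Set.ncard_coe_finset, Nat.cast_le]
  exact Set.ncard_le_ncard (fun y hy => Metric.mem_closedBall'.2 (hs y hy)) (hΓ.ball_finite x n)

theorem IsRegularSpace.card_le_of_dist_lt (hΓ : IsRegularSpace Γ κ ν) (s : Finset Γ) (x : Γ)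
    {r : ℝ} (hr : 0 ≤ r) (hs : ∀ y ∈ s, dist x y < r) : (s.card : ℝ) ≤ κ * (1 + r) ^ ν := by
  have hκ := hΓ.kappa_pos.le
  have hν := hΓ.nu_pos.le
  calc (s.card : ℝ) ≤ κ * ((⌊r⌋₊ : ℝ) + 1) ^ ν :=
        hΓ.card_le s x ⌊r⌋₊ fun y hy => ((hs y hy).trans (Nat.lt_floor_add_one r)).le
    _ ≤ κ * (1 + r) ^ ν := by
        rw [add_comm 1 r]
        gcongr
        exact Nat.floor_le hr

theorem IsRegularSpace.sum_shell_rpow_neg_le (hΓ : IsRegularSpace Γ κ ν) (hε : 0 < ε)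
    (s : Finset Γ) (x : Γ) (n : ℕ) :
    ∑ y ∈ s with ⌊dist x y⌋₊ = n, (1 + dist x y) ^ (-(ν + 1 + ε)) ≤
      κ * (1 / (1 + (n : ℝ)) ^ (1 + ε)) := by
  have hν := hΓ.nu_pos
  have hn : (0 : ℝ) < 1 + n := by positivity
  have hlower (y : Γ) (hy : y ∈ s.filter fun y => ⌊dist x y⌋₊ = n) : (n : ℝ) ≤ dist x y :=
    (Finset.mem_filter.1 hy).2 ▸ Nat.floor_le dist_nonneg
  have hupper (y : Γ) (hy : y ∈ s.filter fun y => ⌊dist x y⌋₊ = n) : dist x y ≤ (n : ℝ) + 1 :=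
    (Finset.mem_filter.1 hy).2 ▸ (Nat.lt_floor_add_one _).le
  calc ∑ y ∈ s with ⌊dist x y⌋₊ = n, (1 + dist x y) ^ (-(ν + 1 + ε))
      ≤ ∑ y ∈ s with ⌊dist x y⌋₊ = n, (1 + (n : ℝ)) ^ (-(ν + 1 + ε)) :=
        Finset.sum_le_sum fun y hy => Real.rpow_le_rpow_of_nonpos hn
          (by linarith [hlower y hy]) (by linarith)
    _ = (Finset.card {y ∈ s | ⌊dist x y⌋₊ = n} : ℝ) * (1 + (n : ℝ)) ^ (-(ν + 1 + ε)) := by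
        rw [Finset.sum_const, nsmul_eq_mul]
    _ ≤ κ * ((n : ℝ) + 1) ^ ν * (1 + (n : ℝ)) ^ (-(ν + 1 + ε)) :=
        mul_le_mul_of_nonneg_right (hΓ.card_le _ x n hupper) (by positivity)
    _ = κ * (1 / (1 + (n : ℝ)) ^ (1 + ε)) := by
        rw [mul_assoc, add_comm (n : ℝ) 1, ← Real.rpow_add hn, one_div, ← Real.rpow_neg hn.le]
        congr 2
        ring

theorem IsRegularSpace.sum_rpow_neg_le (hΓ : IsRegularSpace Γ κ ν) (hε : 0 < ε)
    (s : Finset Γ) (x : Γ) :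
    ∑ y ∈ s, (1 + dist x y) ^ (-(ν + 1 + ε)) ≤ κ * zetaConst ε := by
  set T : Finset ℕ := s.image fun y => ⌊dist x y⌋₊
  calc ∑ y ∈ s, (1 + dist x y) ^ (-(ν + 1 + ε))
      = ∑ n ∈ T, ∑ y ∈ s with ⌊dist x y⌋₊ = n, (1 + dist x y) ^ (-(ν + 1 + ε)) :=
        (Finset.sum_fiberwise_of_maps_to (fun y hy => Finset.mem_image_of_mem _ hy) _).symm
    _ ≤ ∑ n ∈ T, κ * (1 / (1 + (n : ℝ)) ^ (1 + ε)) :=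
        Finset.sum_le_sum fun n _ => hΓ.sum_shell_rpow_neg_le hε s x n
    _ = κ * ∑ n ∈ T, 1 / (1 + (n : ℝ)) ^ (1 + ε) := by rw [Finset.mul_sum]
    _ ≤ κ * zetaConst ε := mul_le_mul_of_nonneg_left
        ((summable_zetaConst hε).sum_le_tsum _ fun n _ => by positivity) hΓ.kappa_pos.le

theorem IsRegularSpace.sum_powerLaw_le (hΓ : IsRegularSpace Γ κ ν) (hε : 0 < ε)
    (hα : 0 ≤ reducedExponent α ν ε) (s : Finset Γ) (x : Γ) {ρ : ℝ} (hρ : 0 ≤ ρ)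
    (hs : ∀ y ∈ s, ρ ≤ dist x y) :
    ∑ y ∈ s, powerLaw α (dist x y) ≤ κ * zetaConst ε * (1 + ρ) ^ (-reducedExponent α ν ε) := by
  have hsplit (y : Γ) : powerLaw α (dist x y) =
      (1 + dist x y) ^ (-(ν + 1 + ε)) * (1 + dist x y) ^ (-reducedExponent α ν ε) := by
    rw [powerLaw_eq_rpow_neg α dist_nonneg, ← Real.rpow_add (by positivity), reducedExponent]
    congr 1
    ring
  calc ∑ y ∈ s, powerLaw α (dist x y)
      ≤ ∑ y ∈ s, (1 + dist x y) ^ (-(ν + 1 + ε)) * (1 + ρ) ^ (-reducedExponent α ν ε) := by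
        refine Finset.sum_le_sum fun y hy => ?_
        rw [hsplit]
        exact mul_le_mul_of_nonneg_left (Real.rpow_le_rpow_of_nonpos (by positivity)
          (by linarith [hs y hy]) (neg_nonpos.2 hα)) (by positivity)
    _ ≤ κ * zetaConst ε * (1 + ρ) ^ (-reducedExponent α ν ε) := by
        rw [← Finset.sum_mul]
        exact mul_le_mul_of_nonneg_right (hΓ.sum_rpow_neg_le hε s x) (by positivity)

theorem IsRegularSpace.decaySum_powerLaw_le (hΓ : IsRegularSpace Γ κ ν) (hε : 0 < ε)
    (hα : 0 ≤ reducedExponent α ν ε) :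
    decaySum Γ (powerLaw α) ≤ ENNReal.ofReal (κ * zetaConst ε) := by
  refine iSup_le fun x => ENNReal.summable.tsum_le_of_sum_le fun s => ?_
  rw [← ENNReal.ofReal_sum_of_nonneg fun y _ => (powerLaw_pos α _ dist_nonneg).le]
  refine ENNReal.ofReal_le_ofReal ?_
  simpa only [add_zero, Real.one_rpow, mul_one] using
    hΓ.sum_powerLaw_le hε hα s x le_rfl fun y _ => dist_nonneg

theorem powerLaw_le_two_rpow_mul (hα : 0 ≤ α) {r s : ℝ} (hr : 0 ≤ r) (hs : 0 ≤ s)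
    (h : s ≤ 2 * r + 1) : powerLaw α r ≤ 2 ^ α * powerLaw α s := by
  rw [powerLaw, powerLaw, mul_one_div, div_le_div_iff₀ (by positivity) (by positivity), one_mul,
    ← Real.mul_rpow zero_le_two (by positivity)]
  exact Real.rpow_le_rpow (by positivity) (by linarith) hα

theorem powerLaw_mul_powerLaw_le (hα : 0 ≤ α) (x y z : Γ) :
    powerLaw α (dist x z) * powerLaw α (dist z y) ≤
      2 ^ α * powerLaw α (dist x y) * (powerLaw α (dist x z) + powerLaw α (dist y z)) := by
  have hF (u v : Γ) : 0 ≤ powerLaw α (dist u v) := (powerLaw_pos α _ dist_nonneg).le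
  have hF0 : 0 ≤ 2 ^ α * powerLaw α (dist x y) := mul_nonneg (by positivity) (hF x y)
  have htri := dist_triangle x z y
  rw [dist_comm y z, mul_add]
  rcases le_total (dist x z) (dist z y) with h | h
  · have hfar := powerLaw_le_two_rpow_mul hα (dist_nonneg (x := z) (y := y))
      (dist_nonneg (x := x) (y := y)) (by linarith)
    linarith [mul_le_mul_of_nonneg_left hfar (hF x z), mul_nonneg hF0 (hF z y)]
  · have hfar := powerLaw_le_two_rpow_mul hα (dist_nonneg (x := x) (y := z))
      (dist_nonneg (x := x) (y := y)) (by linarith)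
    linarith [mul_le_mul_of_nonneg_right hfar (hF z y), mul_nonneg hF0 (hF x z)]

theorem convConst_powerLaw_le (Γ : Type*) [MetricSpace Γ] (hα : 0 ≤ α) :
    convConst Γ (powerLaw α) ≤ ENNReal.ofReal (2 ^ α) * (2 * decaySum Γ (powerLaw α)) := by
  refine sInf_le fun x y => ?_
  have hF (u v : Γ) : 0 ≤ powerLaw α (dist u v) := (powerLaw_pos α _ dist_nonneg).le
  calc ∑' z, ENNReal.ofReal (powerLaw α (dist x z)) * ENNReal.ofReal (powerLaw α (dist z y))
      ≤ ∑' z, ENNReal.ofReal (2 ^ α) * ENNReal.ofReal (powerLaw α (dist x y)) *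
          (ENNReal.ofReal (powerLaw α (dist x z)) + ENNReal.ofReal (powerLaw α (dist y z))) := by
        refine ENNReal.tsum_le_tsum fun z => ?_
        rw [← ENNReal.ofReal_mul (hF _ _), ← ENNReal.ofReal_mul (by positivity),
          ← ENNReal.ofReal_add (hF _ _) (hF _ _),
          ← ENNReal.ofReal_mul (mul_nonneg (by positivity) (hF _ _))]
        exact ENNReal.ofReal_le_ofReal (powerLaw_mul_powerLaw_le hα x y z)
    _ = ENNReal.ofReal (2 ^ α) * ENNReal.ofReal (powerLaw α (dist x y)) *
          (∑' z, ENNReal.ofReal (powerLaw α (dist x z)) +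
            ∑' z, ENNReal.ofReal (powerLaw α (dist y z))) := by
        rw [ENNReal.tsum_mul_left, ENNReal.tsum_add]
    _ ≤ ENNReal.ofReal (2 ^ α) * ENNReal.ofReal (powerLaw α (dist x y)) *
          (decaySum Γ (powerLaw α) + decaySum Γ (powerLaw α)) := by
        gcongr
        · exact le_iSup (fun x => ∑' z, ENNReal.ofReal (powerLaw α (dist x z))) x
        · exact le_iSup (fun y => ∑' z, ENNReal.ofReal (powerLaw α (dist y z))) y
    _ = ENNReal.ofReal (2 ^ α) * (2 * decaySum Γ (powerLaw α)) *
          ENNReal.ofReal (powerLaw α (dist x y)) := by ring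

theorem IsRegularSpace.convConst_powerLaw_lt_top (hΓ : IsRegularSpace Γ κ ν) (hε : 0 < ε)
    (hα : 0 ≤ reducedExponent α ν ε) : convConst Γ (powerLaw α) < ⊤ := by
  have hα0 : 0 ≤ α := by
    unfold reducedExponent at hα
    linarith [hΓ.nu_pos]
  have hsum : decaySum Γ (powerLaw α) < ⊤ :=
    (hΓ.decaySum_powerLaw_le hε hα).trans_lt ENNReal.ofReal_lt_top
  exact (convConst_powerLaw_le Γ hα0).trans_lt <|
    ENNReal.mul_lt_top ENNReal.ofReal_lt_top (ENNReal.mul_lt_top ENNReal.ofNat_lt_top hsum)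

theorem IsRegularSpace.one_le_convConst_powerLaw [Nonempty Γ] (hΓ : IsRegularSpace Γ κ ν)
    (hε : 0 < ε) (hα : 0 ≤ reducedExponent α ν ε) : 1 ≤ (convConst Γ (powerLaw α)).toReal := by
  have h0 : powerLaw α 0 = 1 := by rw [powerLaw, add_zero, Real.one_rpow, div_one]
  have h := ofReal_zero_le_convConst (Γ := Γ) (powerLaw_pos α 0 le_rfl)
  rw [h0, ENNReal.ofReal_one] at h
  simpa only [ENNReal.toReal_one] using
    ENNReal.toReal_mono (hΓ.convConst_powerLaw_lt_top hε hα).ne h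

end PowerLaw

/-! ### Decoupled dynamics -/

section Dynamics

variable {Γ : Type*} {Λ : Finset Γ}

/-- The subsets of `Λ`, which index the terms of the finite-volume generator in `Λ`. -/
abbrev Region (Λ : Finset Γ) := {Z : Finset Γ // Z ∈ Λ.powerset}

theorem Region.subset (Z : Region Λ) : Z.1 ⊆ Λ := Finset.mem_powerset.1 Z.2

variable [DecidableEq Γ] {q : Γ → ℕ}

/-- The term `L_Z ⊗ id` of the finite-volume generator, as a bounded operator on the observables
in `Λ`. -/
def localMap (L : DissipativeInteraction q) (Λ : Finset Γ) (Z : Region Λ) :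
    Obs q Λ →L[ℂ] Obs q Λ :=
  LinearMap.toContinuousLinearMap (extend Z.subset (L.map Z.1))

theorem localMap_apply (L : DissipativeInteraction q) (Z : Region Λ) (M : Obs q Λ) :
    localMap L Λ Z M = extend Z.subset (L.map Z.1) M := rfl

theorem dynamics_apply (L : DissipativeInteraction q) (Λ : Finset Γ) (t : ℝ) (M : Obs q Λ) :
    dynamics L Λ t M = flow (∑ Z, localMap L Λ Z) t M := by
  have h : LinearMap.toContinuousLinearMap (generator L Λ) = ∑ Z, localMap L Λ Z :=
    map_sum LinearMap.toContinuousLinearMap _ _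
  rw [← h]
  rfl

theorem norm_flow_localMap_apply_le (L : DissipativeInteraction q) (J : Finset (Region Λ)) {t : ℝ}
    (ht : 0 ≤ t) (M : Obs q Λ) : ‖flow (∑ Z ∈ J, localMap L Λ Z) t M‖ ≤ ‖M‖ := by
  have h : LinearMap.toContinuousLinearMap (∑ Z ∈ J, extend Z.subset (L.map Z.1)) =
      ∑ Z ∈ J, localMap L Λ Z :=
    map_sum LinearMap.toContinuousLinearMap _ _
  rw [← h]
  exact (IsLindblad.sum J fun Z _ => isLindblad_extend Z.subset (L.lindblad Z.1)).norm_flow_apply_le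
    ht M

variable (L : DissipativeInteraction q) {X Y : Finset Γ} {M N : Obs q Λ}

theorem localMap_eq_zero (hX : X ⊆ Λ) (hM : M ∈ localAlgebra q hX) {Z : Region Λ}
    (hd : Disjoint Z.1 X) : localMap L Λ Z M = 0 :=
  extend_eq_zero Z.subset (L.lindblad Z.1) (commute_embed_of_mem_localAlgebra hX Z.subset hd hM)

theorem flow_mem_localAlgebra (hX : X ⊆ Λ) {J : Finset (Region Λ)}
    (hJ : ∀ Z ∈ J, Z.1 ⊆ X ∨ Disjoint Z.1 X) (hM : M ∈ localAlgebra q hX) (t : ℝ) :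
    flow (∑ Z ∈ J, localMap L Λ Z) t M ∈ localAlgebra q hX := by
  let V : Submodule ℂ (Obs q Λ) := (localAlgebra q hX).toSubalgebra.toSubmodule
  refine flow_apply_mem (p := V) V.closed_of_finiteDimensional (fun N hN => ?_) hM t
  rw [sum_apply]
  refine V.sum_mem fun Z hZ => ?_
  rcases hJ Z hZ with h | h
  · exact extend_mem_localAlgebra hX h (L.lindblad Z.1) hN
  · rw [localMap_eq_zero L hX hN h]
    exact V.zero_mem

theorem localMap_mul (hX : X ⊆ Λ) (hY : Y ⊆ Λ) (hXY : Disjoint X Y) {Z : Region Λ}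
    (hZ : Z.1 ⊆ X ∨ Z.1 ⊆ Y) (hM : M ∈ localAlgebra q hX) (hN : N ∈ localAlgebra q hY) :
    localMap L Λ Z (M * N) = localMap L Λ Z M * N + M * localMap L Λ Z N := by
  rcases hZ with h | h
  · have hd : Disjoint Z.1 Y := hXY.mono_left h
    rw [localMap_eq_zero L hY hN hd, mul_zero, add_zero]
    exact extend_mul_right Z.subset (L.lindblad Z.1)
      (commute_embed_of_mem_localAlgebra hY Z.subset hd hN) M
  · have hd : Disjoint Z.1 X := hXY.symm.mono_left h
    rw [localMap_eq_zero L hX hM hd, zero_mul, zero_add]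
    exact extend_mul_left Z.subset (L.lindblad Z.1)
      (commute_embed_of_mem_localAlgebra hX Z.subset hd hM) N

theorem flow_mul_apply_self (hX : X ⊆ Λ) (hY : Y ⊆ Λ) (hXY : Disjoint X Y)
    {J : Finset (Region Λ)} (hJ : ∀ Z ∈ J, Z.1 ⊆ X ∨ Z.1 ⊆ Y) (hM : M ∈ localAlgebra q hX)
    (hN : N ∈ localAlgebra q hY) (t : ℝ) (σ : Config q Λ) :
    flow (∑ Z ∈ J, localMap L Λ Z) t (M * N) σ σ =
      flow (∑ Z ∈ J, localMap L Λ Z) t M σ σ * flow (∑ Z ∈ J, localMap L Λ Z) t N σ σ := by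
  set G := ∑ Z ∈ J, localMap L Λ Z with hG
  have hMt (s : ℝ) : flow G s M ∈ localAlgebra q hX := flow_mem_localAlgebra L hX
    (fun Z hZ => (hJ Z hZ).imp_right fun h => hXY.symm.mono_left h) hM s
  have hNt (s : ℝ) : flow G s N ∈ localAlgebra q hY := flow_mem_localAlgebra L hY
    (fun Z hZ => (hJ Z hZ).symm.imp_right fun h => hXY.mono_left h) hN s
  have hleibniz (s : ℝ) : G (flow G s M * flow G s N) =
      G (flow G s M) * flow G s N + flow G s M * G (flow G s N) := by
    have hMs := hMt s
    have hNs := hNt s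
    generalize flow G s M = P at hMs ⊢
    generalize flow G s N = Q at hNs ⊢
    rw [hG, sum_apply, sum_apply, sum_apply, Finset.sum_mul, Finset.mul_sum,
      ← Finset.sum_add_distrib]
    exact Finset.sum_congr rfl fun Z hZ => localMap_mul L hX hY hXY (hJ Z hZ) hMs hNs
  rw [flow_apply_mul hleibniz, mul_apply_self_of_mem_localAlgebra hX hY hXY (hMt t) (hNt t)]

end Dynamics

section VectorState

variable {S : Type*} [Fintype S] [DecidableEq S]

/-- The vector state of the basis vector `σ`, which takes a matrix to its diagonal entry at `σ`. On
a spin system it is a product state. -/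
def entryFunctional (σ : S) : Matrix S S ℂ →ₗ[ℂ] ℂ where
  toFun M := M σ σ
  map_add' _ _ := rfl
  map_smul' _ _ := rfl

theorem isState_entryFunctional (σ : S) : IsState (entryFunctional σ) where
  map_one := Matrix.one_apply_eq σ
  nonneg M := by
    have h : entryFunctional σ (star M * M) = ((∑ τ, Complex.normSq (M τ σ) : ℝ) : ℂ) :=
      calc ∑ τ, star (M τ σ) * M τ σ = ∑ τ, (Complex.normSq (M τ σ) : ℂ) :=
            Finset.sum_congr rfl fun τ _ => (Complex.normSq_eq_conj_mul_self).symm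
        _ = _ := (Complex.ofReal_sum _ _).symm
    rw [h, Complex.ofReal_re, Complex.ofReal_im]
    exact ⟨Finset.sum_nonneg fun τ _ => Complex.normSq_nonneg _, rfl⟩

theorem IsState.nonempty {π : Matrix S S ℂ →ₗ[ℂ] ℂ} (hπ : IsState π) : Nonempty S := by
  by_contra! h
  have h1 := hπ.map_one
  rw [Subsingleton.elim (1 : Matrix S S ℂ) 0, map_zero] at h1
  exact zero_ne_one h1

end VectorState

/-! ### Cutting the range of the interaction -/

section Approximation

variable {Γ : Type*} [MetricSpace Γ] {Λ : Finset Γ} {r R : ℝ}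

/-- The regions of diameter at most `R`, which carry the terms kept by a cut-off at range `R`. -/
def shortRegions (Λ : Finset Γ) (R : ℝ) : Finset (Region Λ) :=
  {Z | ∀ y ∈ Z.1, ∀ z ∈ Z.1, dist y z ≤ R}

theorem mem_shortRegions {Z : Region Λ} :
    Z ∈ shortRegions Λ R ↔ ∀ y ∈ Z.1, ∀ z ∈ Z.1, dist y z ≤ R :=
  Finset.mem_filter_univ Z

theorem exists_half_le_dist_of_notMem_shortRegions {Z : Region Λ} (hZ : Z ∉ shortRegions Λ R)
    (x : Γ) : ∃ y ∈ Z.1, R / 2 ≤ dist x y := by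
  rw [mem_shortRegions] at hZ
  push Not at hZ
  obtain ⟨y, hy, z, hz, hyz⟩ := hZ
  have htri := dist_triangle_left y z x
  rcases le_total (R / 2) (dist x y) with h | h
  · exact ⟨y, hy, h⟩
  · exact ⟨z, hz, by linarith⟩

theorem truncatedKernel_le {F : ℝ → ℝ} (hF : ∀ r, 0 ≤ r → 0 < F r) (hR : 0 < R)
    {x y : Γ} (hxy : r ≤ dist x y) :
    truncatedKernel F R y x ≤ Real.exp (-(r / R)) * F (dist x y) := by
  rw [truncatedKernel, dist_comm, mul_comm]
  have hF0 := (hF _ (dist_nonneg (x := x) (y := y))).le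
  gcongr

variable [DecidableEq Γ] {q : Γ → ℕ} {L : DissipativeInteraction q} {F : ℝ → ℝ}

theorem localGenerators_localMap (hF : ∀ r, 0 ≤ r → 0 < F r) (hL : interactionNorm F L < ⊤)
    (Λ : Finset Γ) :
    LocalGenerators (localMap L Λ) (fun Z => Z.1) (fun Z => (cbNorm (L.map Z.1)).toReal) Λ where
  nonneg _ := ENNReal.toReal_nonneg
  norm_le Z M := by
    rcases Z with ⟨Z, hZ⟩
    rcases Z.eq_empty_or_nonempty with rfl | hne
    -- `cbNorm (L.map ∅)` is not controlled by the interaction norm, but `L.map ∅` vanishes.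
    · have h : localMap L Λ ⟨∅, hZ⟩ M = 0 := by
        rw [localMap_apply, (L.lindblad ∅).eq_zero]
        rfl
      rw [h, norm_zero]
      exact mul_nonneg ENNReal.toReal_nonneg (norm_nonneg M)
    · exact norm_extend_le _ (cbNorm_lt_top hF hL hne) M
  supp_subset := Region.subset
  commute Z W hd := by
    ext1 M
    exact extend_comm Z.subset W.subset hd (L.lindblad Z.1) (L.lindblad W.1) M
  contraction J _ M hs := norm_flow_localMap_apply_le L J hs M

variable {X Ω : Finset Γ} {J K : Finset (Region Λ)} {M : Obs q Λ} {s : ℝ}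

theorem sum_cbNorm_long_le (hF : ∀ r, 0 ≤ r → 0 < F r) (hL : interactionNorm F L < ⊤) (z : Γ) :
    ∑ Z ∈ Finset.univ \ shortRegions Λ R with z ∈ Z.1, (cbNorm (L.map Z.1)).toReal ≤
      (interactionNorm F L).toReal * ∑ y ∈ Λ with R / 2 ≤ dist z y, F (dist z y) := by
  have hmeet (Z) (hZ : Z ∈ {Z ∈ Finset.univ \ shortRegions Λ R | z ∈ Z.1}) :
      ¬ Disjoint Z.1 {y ∈ Λ | R / 2 ≤ dist z y} := by
    obtain ⟨y, hy, hzy⟩ := exists_half_le_dist_of_notMem_shortRegions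
      (Finset.mem_sdiff.1 (Finset.mem_filter.1 hZ).1).2 z
    exact Finset.not_disjoint_iff.2 ⟨y, hy, Finset.mem_filter.2 ⟨Z.subset hy, hzy⟩⟩
  rw [Finset.mul_sum]
  refine (sum_le_sum_sum_filter_mem (supp := fun Z : Region Λ => Z.1)
    (fun _ => ENNReal.toReal_nonneg) hmeet).trans (Finset.sum_le_sum fun y _ => ?_)
  rw [Finset.filter_filter]
  exact sum_cbNorm_le hF hL _ Subtype.val_injective z y

theorem sum_norm_localMap_long_le (hF : ∀ r, 0 ≤ r → 0 < F r) (hL : interactionNorm F L < ⊤)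
    (hX : X ⊆ Λ) (hXΩ : X ⊆ Ω) (hJΩ : ∀ Z ∈ J, Z.1 ⊆ Ω) (hM : M ∈ localAlgebra q hX)
    (hs : 0 ≤ s) :
    ∑ Z ∈ Finset.univ \ shortRegions Λ R,
        ‖localMap L Λ Z (flow (∑ Z ∈ J, localMap L Λ Z) s M)‖ ≤
      ‖M‖ * ((interactionNorm F L).toReal *
        ∑ z ∈ Ω, ∑ y ∈ Λ with R / 2 ≤ dist z y, F (dist z y)) := by
  refine ((localGenerators_localMap hF hL Λ).sum_norm_apply_flow_le_of_subset hXΩ hJΩ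
    (fun Z hd => localMap_eq_zero L hX hM hd) hs).trans ?_
  refine mul_le_mul_of_nonneg_left ?_ (norm_nonneg M)
  rw [Finset.mul_sum]
  exact Finset.sum_le_sum fun z _ => sum_cbNorm_long_le hF hL z

theorem sum_norm_localMap_short_le [Nonempty Γ] (hF : ∀ r, 0 ≤ r → 0 < F r)
    (hC : convConst Γ F < ⊤) (hL : interactionNorm F L < ⊤) (hX : X ⊆ Λ) (hR : 0 < R)
    (hJ : J ⊆ shortRegions Λ R) (hK : K ⊆ shortRegions Λ R)
    (hfar : ∀ Z ∈ K, ∀ x ∈ X, ∃ y ∈ Z.1, r ≤ dist x y) (hM : M ∈ localAlgebra q hX)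
    (hs : 0 ≤ s) :
    ∑ Z ∈ K, ‖localMap L Λ Z (flow (∑ Z ∈ J, localMap L Λ Z) s M)‖ ≤
      ‖M‖ * ((interactionNorm F L).toReal * Real.exp 1) *
        Real.exp ((interactionNorm F L).toReal * Real.exp 1 * (convConst Γ F).toReal * s) *
          ∑ x ∈ X, Real.exp (-(r / R)) * ∑ y ∈ Λ with r ≤ dist x y, F (dist x y) := by
  have hkernel {I : Finset (Region Λ)} (hI : I ⊆ shortRegions Λ R) (y z : Γ) :=
    sum_cbNorm_le_truncatedKernel hF hL (supp := fun Z : Region Λ => Z.1) Subtype.val_injective hR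
      (fun Z hZ => mem_shortRegions.1 (hI hZ)) y z
  have hmeet (x) (hx : x ∈ X) (Z) (hZ : Z ∈ K) : ¬ Disjoint Z.1 {y ∈ Λ | r ≤ dist x y} := by
    obtain ⟨y, hy, hxy⟩ := hfar Z hZ x hx
    exact Finset.not_disjoint_iff.2 ⟨y, hy, Finset.mem_filter.2 ⟨Z.subset hy, hxy⟩⟩
  refine ((localGenerators_localMap hF hL Λ).sum_norm_apply_flow_le
    (isConvolutionKernel_truncatedKernel hF hC hR.le Λ) (by positivity) (hkernel hJ) (hkernel hK)
    hX (fun Z hd => localMap_eq_zero L hX hM hd) hmeet hs).trans ?_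
  refine mul_le_mul_of_nonneg_left (Finset.sum_le_sum fun x _ => ?_) (by positivity)
  rw [Finset.mul_sum]
  exact Finset.sum_le_sum fun y hy => truncatedKernel_le hF hR (Finset.mem_filter.1 hy).2

variable {κ ν α ε : ℝ}

theorem norm_flow_sub_flow_shortRegions_le [Nonempty Γ] (hΓ : IsRegularSpace Γ κ ν) (hε : 0 < ε)
    (hα : 0 ≤ reducedExponent α ν ε) (hL : interactionNorm (powerLaw α) L < ⊤) (hX : X ⊆ Λ)
    (hXΩ : X ⊆ Ω) (hr : 0 ≤ r) (hR : 0 < R) (hJ : J ⊆ shortRegions Λ R)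
    (hJΩ : ∀ Z ∈ J, Z.1 ⊆ Ω)
    (hfar : ∀ Z ∈ shortRegions Λ R \ J, ∀ x ∈ X, ∃ y ∈ Z.1, r ≤ dist x y)
    (hM : M ∈ localAlgebra q hX) {t : ℝ} (ht : 0 ≤ t) :
    ‖flow (∑ Z, localMap L Λ Z) t M - flow (∑ Z ∈ J, localMap L Λ Z) t M‖ ≤
      ‖M‖ * (interactionNorm (powerLaw α) L).toReal * (κ * zetaConst ε) *
        (Ω.card * (1 + R / 2) ^ (-reducedExponent α ν ε) +
          X.card * Real.exp 1 * Real.exp (Real.exp 1 * velocity α L * t - r / R) *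
            (1 + r) ^ (-reducedExponent α ν ε)) * t := by
  have hF := powerLaw_pos α
  have htail {ρ : ℝ} (hρ : 0 ≤ ρ) (x : Γ) :
      ∑ y ∈ Λ with ρ ≤ dist x y, powerLaw α (dist x y) ≤
        κ * zetaConst ε * (1 + ρ) ^ (-reducedExponent α ν ε) :=
    hΓ.sum_powerLaw_le hε hα _ x hρ fun y hy => (Finset.mem_filter.1 hy).2
  refine (localGenerators_localMap hF hL Λ).norm_flow_sub_flow_le (Finset.subset_univ J) ht
    fun s hs => ?_
  rw [← Finset.sdiff_union_sdiff_cancel (Finset.subset_univ _) hJ,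
    Finset.sum_union (Finset.sdiff_disjoint.mono_right Finset.sdiff_subset)]
  have hlong := sum_norm_localMap_long_le (R := R) hF hL hX hXΩ hJΩ hM hs.1
  have hshort := sum_norm_localMap_short_le hF (hΓ.convConst_powerLaw_lt_top hε hα) hL hX hR hJ
    Finset.sdiff_subset hfar hM hs.1
  set l := (interactionNorm (powerLaw α) L).toReal
  have hexp : Real.exp (l * Real.exp 1 * (convConst Γ (powerLaw α)).toReal * s) ≤
      Real.exp (Real.exp 1 * velocity α L * t) := by
    rw [velocity, mul_left_comm, ← mul_assoc]
    exact Real.exp_le_exp.2 (mul_le_mul_of_nonneg_left hs.2 (by positivity))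
  have hlong' : ∑ z ∈ Ω, ∑ y ∈ Λ with R / 2 ≤ dist z y, powerLaw α (dist z y) ≤
      Ω.card * (κ * zetaConst ε * (1 + R / 2) ^ (-reducedExponent α ν ε)) := by
    rw [← nsmul_eq_mul]
    exact Finset.sum_le_card_nsmul _ _ _ fun z _ => htail (half_pos hR).le z
  have hshort' : ∑ x ∈ X, Real.exp (-(r / R)) *
      ∑ y ∈ Λ with r ≤ dist x y, powerLaw α (dist x y) ≤ X.card * (Real.exp (-(r / R)) *
        (κ * zetaConst ε * (1 + r) ^ (-reducedExponent α ν ε))) := by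
    rw [← nsmul_eq_mul]
    exact Finset.sum_le_card_nsmul _ _ _ fun x _ =>
      mul_le_mul_of_nonneg_left (htail hr x) (Real.exp_pos _).le
  calc _ ≤ ‖M‖ * (l * (Ω.card * (κ * zetaConst ε * (1 + R / 2) ^ (-reducedExponent α ν ε)))) +
        ‖M‖ * (l * Real.exp 1) * Real.exp (Real.exp 1 * velocity α L * t) *
          (X.card * (Real.exp (-(r / R)) *
            (κ * zetaConst ε * (1 + r) ^ (-reducedExponent α ν ε)))) := by
        have hnonneg : 0 ≤ ∑ x ∈ X, Real.exp (-(r / R)) *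
            ∑ y ∈ Λ with r ≤ dist x y, powerLaw α (dist x y) :=
          Finset.sum_nonneg fun x _ => mul_nonneg (Real.exp_pos _).le
            (Finset.sum_nonneg fun y _ => (hF _ dist_nonneg).le)
        refine add_le_add (hlong.trans ?_) (hshort.trans ?_) <;> gcongr
    _ = _ := by
        rw [sub_eq_add_neg, Real.exp_add]
        ring

end Approximation

/-! ### Decoupling two distant regions -/

section Neighbourhoods

variable {Γ : Type*} [MetricSpace Γ] {κ ν : ℝ} {Λ X Y : Finset Γ} {r R : ℝ} {x y z : Γ}

theorem setDist_le_dist (hx : x ∈ X) (hy : y ∈ Y) : setDist X Y ≤ dist x y := by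
  refine csInf_le ⟨0, ?_⟩ ⟨x, hx, y, hy, rfl⟩
  rintro _ ⟨x, -, y, -, rfl⟩
  exact dist_nonneg

theorem nonempty_of_setDist_pos (h : 0 < setDist X Y) : Nonempty Γ := by
  rcases X.eq_empty_or_nonempty with rfl | ⟨x, -⟩
  · simp [setDist] at h
  · exact ⟨x⟩

/-- The open `r`-neighbourhood of `X` in `Λ`. -/
def neighbourhood (Λ X : Finset Γ) (r : ℝ) : Finset Γ :=
  open scoped Classical in {z ∈ Λ | ∃ x ∈ X, dist x z < r}

theorem mem_neighbourhood : z ∈ neighbourhood Λ X r ↔ z ∈ Λ ∧ ∃ x ∈ X, dist x z < r :=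
  Finset.mem_filter

theorem neighbourhood_subset : neighbourhood Λ X r ⊆ Λ :=
  Finset.filter_subset _ _

theorem subset_neighbourhood (hX : X ⊆ Λ) (hr : 0 < r) : X ⊆ neighbourhood Λ X r := fun x hx =>
  mem_neighbourhood.2 ⟨hX hx, x, hx, by rwa [dist_self]⟩

theorem disjoint_neighbourhood (h : ∀ x ∈ X, ∀ y ∈ Y, 2 * r ≤ dist x y) :
    Disjoint (neighbourhood Λ X r) (neighbourhood Λ Y r) := by
  refine Finset.disjoint_left.2 fun z hzX hzY => ?_
  obtain ⟨-, x, hx, hxz⟩ := mem_neighbourhood.1 hzX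
  obtain ⟨-, y, hy, hyz⟩ := mem_neighbourhood.1 hzY
  linarith [h x hx y hy, dist_triangle_right x y z]

theorem exists_le_dist_of_not_subset_neighbourhood {Z : Region Λ}
    (hZ : ¬ Z.1 ⊆ neighbourhood Λ X r) (hx : x ∈ X) : ∃ y ∈ Z.1, r ≤ dist x y := by
  obtain ⟨y, hy, hyX⟩ := Finset.not_subset.1 hZ
  exact ⟨y, hy, not_lt.1 fun h => hyX (mem_neighbourhood.2 ⟨Z.subset hy, x, hx, h⟩)⟩

theorem IsRegularSpace.card_neighbourhood_le (hΓ : IsRegularSpace Γ κ ν) (Λ X : Finset Γ)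
    (hr : 0 ≤ r) : ((neighbourhood Λ X r).card : ℝ) ≤ X.card * (κ * (1 + r) ^ ν) := by
  classical
  have hsub : neighbourhood Λ X r ⊆ X.biUnion fun x => {z ∈ Λ | dist x z < r} := by
    intro z hz
    obtain ⟨hz, x, hx, hd⟩ := mem_neighbourhood.1 hz
    exact Finset.mem_biUnion.2 ⟨x, hx, Finset.mem_filter.2 ⟨hz, hd⟩⟩
  calc ((neighbourhood Λ X r).card : ℝ)
      ≤ ∑ x ∈ X, (Finset.card {z ∈ Λ | dist x z < r} : ℝ) := by
        exact_mod_cast (Finset.card_le_card hsub).trans Finset.card_biUnion_le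
    _ ≤ ∑ _x ∈ X, κ * (1 + r) ^ ν := Finset.sum_le_sum fun x _ =>
        hΓ.card_le_of_dist_lt _ x hr fun y hy => (Finset.mem_filter.1 hy).2
    _ = X.card * (κ * (1 + r) ^ ν) := by rw [Finset.sum_const, nsmul_eq_mul]

variable [DecidableEq Γ]

/-- The regions of diameter at most `R` inside the `r`-neighbourhood of `X` or inside that of `Y`.
When these neighbourhoods are disjoint, the corresponding dynamics does not couple `X` to `Y`. -/
def decoupledRegions (Λ X Y : Finset Γ) (r R : ℝ) : Finset (Region Λ) :=
  {Z ∈ shortRegions Λ R | Z.1 ⊆ neighbourhood Λ X r ∨ Z.1 ⊆ neighbourhood Λ Y r}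

theorem mem_decoupledRegions {Z : Region Λ} :
    Z ∈ decoupledRegions Λ X Y r R ↔
      Z ∈ shortRegions Λ R ∧ (Z.1 ⊆ neighbourhood Λ X r ∨ Z.1 ⊆ neighbourhood Λ Y r) :=
  Finset.mem_filter

theorem exists_le_dist_of_mem_shortRegions_sdiff {Z : Region Λ}
    (hZ : Z ∈ shortRegions Λ R \ decoupledRegions Λ X Y r R) (hx : x ∈ X ∪ Y) :
    ∃ y ∈ Z.1, r ≤ dist x y := by
  rw [Finset.mem_sdiff, mem_decoupledRegions, not_and, not_or] at hZ
  obtain ⟨hZX, hZY⟩ := hZ.2 hZ.1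
  exact (Finset.mem_union.1 hx).elim (exists_le_dist_of_not_subset_neighbourhood hZX)
    (exists_le_dist_of_not_subset_neighbourhood hZY)

theorem IsRegularSpace.card_neighbourhood_union_le (hΓ : IsRegularSpace Γ κ ν)
    (Λ X Y : Finset Γ) (hr : 0 ≤ r) :
    ((neighbourhood Λ X r ∪ neighbourhood Λ Y r).card : ℝ) ≤
      (X.card + Y.card) * (κ * (1 + r) ^ ν) := by
  rw [add_mul]
  exact (Nat.cast_le.2 (Finset.card_union_le _ _)).trans <| (Nat.cast_add _ _).trans_le <|
    add_le_add (hΓ.card_neighbourhood_le Λ X hr) (hΓ.card_neighbourhood_le Λ Y hr)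

end Neighbourhoods

section Exponents

variable {r a ν δ η p : ℝ}

theorem one_add_half_rpow_rpow_neg_le (hr : 0 ≤ r) (hδ0 : 0 ≤ δ) (hδ1 : δ ≤ 1) (ha : 0 ≤ a) :
    (1 + r ^ (1 - δ) / 2) ^ (-a) ≤ 2 ^ a * (1 + r) ^ (-((1 - δ) * a)) := by
  have hsub : (1 + r) ^ (1 - δ) ≤ 1 + r ^ (1 - δ) := by
    have h := Real.rpow_add_le_add_rpow zero_le_one hr (sub_nonneg.2 hδ1) (by linarith)
    rwa [Real.one_rpow] at h
  have hpos : 0 < (1 + r) ^ (1 - δ) := by positivity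
  calc (1 + r ^ (1 - δ) / 2) ^ (-a) ≤ ((1 + r) ^ (1 - δ) / 2) ^ (-a) :=
        Real.rpow_le_rpow_of_nonpos (by positivity) (by linarith) (neg_nonpos.2 ha)
    _ = 2 ^ a * (1 + r) ^ (-((1 - δ) * a)) := by
        rw [Real.div_rpow hpos.le zero_le_two, ← Real.rpow_mul (by positivity),
          Real.rpow_neg zero_le_two, div_inv_eq_mul, mul_comm, mul_neg]

theorem one_add_rpow_mul_half_rpow_rpow_neg_le (hr : 0 ≤ r) (hδ0 : 0 ≤ δ) (hδ1 : δ ≤ 1)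
    (ha : 0 ≤ a) (ν : ℝ) :
    (1 + r) ^ ν * (1 + r ^ (1 - δ) / 2) ^ (-a) ≤ 2 ^ a * (1 + r) ^ (-((1 - δ) * a - ν)) := by
  calc (1 + r) ^ ν * (1 + r ^ (1 - δ) / 2) ^ (-a)
      ≤ (1 + r) ^ ν * (2 ^ a * (1 + r) ^ (-((1 - δ) * a))) :=
        mul_le_mul_of_nonneg_left (one_add_half_rpow_rpow_neg_le hr hδ0 hδ1 ha) (by positivity)
    _ = 2 ^ a * (1 + r) ^ (-((1 - δ) * a - ν)) := by
        rw [mul_left_comm, ← Real.rpow_add (by positivity), ← sub_eq_add_neg, neg_sub]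

theorem exp_rpow_sub_div_rpow_le_one (hr : 1 ≤ r) (hηδ : η ≤ δ) :
    Real.exp (r ^ η - r / r ^ (1 - δ)) ≤ 1 := by
  have hdiv : r / r ^ (1 - δ) = r ^ δ := by
    have h := Real.rpow_sub (zero_lt_one.trans_le hr) 1 (1 - δ)
    rwa [sub_sub_cancel, Real.rpow_one, eq_comm] at h
  rw [hdiv, Real.exp_le_one_iff, sub_nonpos]
  exact Real.rpow_le_rpow_of_exponent_le hr hηδ

theorem rpow_mul_one_add_rpow_neg_le (hr : 0 ≤ r) (hη : 0 ≤ η) (hp : η ≤ p) :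
    r ^ η * (1 + r) ^ (-p) ≤ 2 ^ (p - η) * (1 / (1 + 2 * r) ^ (p - η)) := by
  calc r ^ η * (1 + r) ^ (-p) ≤ (1 + r) ^ η * (1 + r) ^ (-p) := by
        gcongr
        linarith
    _ = (1 + r)⁻¹ ^ (p - η) := by
        rw [← Real.rpow_add (by positivity), ← sub_eq_add_neg, ← neg_sub,
          Real.inv_rpow (by positivity), Real.rpow_neg (by positivity)]
    _ ≤ (2 / (1 + 2 * r)) ^ (p - η) := by
        refine Real.rpow_le_rpow (by positivity) ?_ (sub_nonneg.2 hp)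
        rw [inv_eq_one_div, div_le_div_iff₀ (by positivity) (by positivity)]
        linarith
    _ = 2 ^ (p - η) * (1 / (1 + 2 * r) ^ (p - η)) := by
        rw [Real.div_rpow zero_le_two (by positivity), mul_one_div]

theorem tail_add_leak_le {κ n N m : ℝ} (hr : 1 ≤ r) (hν : 0 ≤ ν) (hκ : 0 ≤ κ) (hδ0 : 0 ≤ δ)
    (hδ1 : δ ≤ 1) (ha : 0 ≤ a) (hηδ : η ≤ δ) (hn : 0 ≤ n) (hN : N ≤ n * (κ * (1 + r) ^ ν))
    (hm : m ≤ n) :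
    N * (1 + r ^ (1 - δ) / 2) ^ (-a) +
        m * Real.exp 1 * Real.exp (r ^ η - r / r ^ (1 - δ)) * (1 + r) ^ (-a) ≤
      n * (κ * 2 ^ a + Real.exp 1) * (1 + r) ^ (-((1 - δ) * a - ν)) := by
  have hr0 : 0 ≤ r := zero_le_one.trans hr
  have htail : N * (1 + r ^ (1 - δ) / 2) ^ (-a) ≤
      n * κ * (2 ^ a * (1 + r) ^ (-((1 - δ) * a - ν))) := by
    calc N * (1 + r ^ (1 - δ) / 2) ^ (-a)
        ≤ n * (κ * (1 + r) ^ ν) * (1 + r ^ (1 - δ) / 2) ^ (-a) :=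
          mul_le_mul_of_nonneg_right hN (by positivity)
      _ = n * κ * ((1 + r) ^ ν * (1 + r ^ (1 - δ) / 2) ^ (-a)) := by ring
      _ ≤ _ := mul_le_mul_of_nonneg_left
          (one_add_rpow_mul_half_rpow_rpow_neg_le hr0 hδ0 hδ1 ha ν) (by positivity)
  have hleak : m * Real.exp 1 * Real.exp (r ^ η - r / r ^ (1 - δ)) * (1 + r) ^ (-a) ≤
      n * Real.exp 1 * 1 * (1 + r) ^ (-((1 - δ) * a - ν)) := by
    have hexp := exp_rpow_sub_div_rpow_le_one hr hηδ
    have hexponent : -a ≤ -((1 - δ) * a - ν) := by linarith [mul_nonneg hδ0 ha]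
    gcongr
    linarith
  linarith

end Exponents

section Constants

variable {Γ : Type*} [MetricSpace Γ] [Nonempty Γ] {κ ν α ε δ : ℝ}

theorem IsRegularSpace.le_localityConst (hΓ : IsRegularSpace Γ κ ν) (hε : 0 < ε)
    (hα : 0 ≤ reducedExponent α ν ε) (hδ : δ ≤ 1) :
    κ * zetaConst ε * (κ * 2 ^ reducedExponent α ν ε + Real.exp 1) ≤
      localityConst Γ κ ν α ε δ := by
  have hC := hΓ.one_le_convConst_powerLaw hε hα
  have hF : 0 ≤ (decaySum Γ (powerLaw α)).toReal := ENNReal.toReal_nonneg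
  have hκ := hΓ.kappa_pos
  have hζ := zetaConst_nonneg ε
  rw [localityConst]
  set C := (convConst Γ (powerLaw α)).toReal
  set F := (decaySum Γ (powerLaw α)).toReal
  set a := reducedExponent α ν ε
  have hratio {u : ℝ} (hu : 0 ≤ u) : 1 ≤ (u + C) / C := by
    rw [one_le_div (by positivity)]
    linarith
  have hpow : (2 : ℝ) ^ a ≤ 2 ^ (2 * a) * 2 ^ (1 - δ) * ((zetaConst ε + C) / C) := by
    have h2 : (2 : ℝ) ^ a ≤ 2 ^ (2 * a) :=
      Real.rpow_le_rpow_of_exponent_le one_le_two (by linarith)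
    rw [mul_assoc]
    exact h2.trans <| le_mul_of_one_le_right (by positivity) <|
      one_le_mul_of_one_le_of_one_le (Real.one_le_rpow one_le_two (sub_nonneg.2 hδ)) (hratio hζ)
  calc κ * zetaConst ε * (κ * 2 ^ a + Real.exp 1)
      ≤ κ * zetaConst ε * (κ * (2 ^ (2 * a) * 2 ^ (1 - δ) * ((zetaConst ε + C) / C)) +
          Real.exp 1 * ((F + C) / C)) := by
        gcongr
        exact le_mul_of_one_le_right (Real.exp_pos 1).le (hratio hF)
    _ = _ := by ring

variable [DecidableEq Γ] {q : Γ → ℕ} {L : DissipativeInteraction q}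

theorem IsRegularSpace.velocity_pos (hΓ : IsRegularSpace Γ κ ν) (hε : 0 < ε)
    (hα : 0 ≤ reducedExponent α ν ε) (hL : interactionNorm (powerLaw α) L < ⊤)
    (hL0 : 0 < interactionNorm (powerLaw α) L) : 0 < velocity α L :=
  mul_pos (ENNReal.toReal_pos hL0.ne' hL.ne)
    (zero_lt_one.trans_le (hΓ.one_le_convConst_powerLaw hε hα))

end Constants

section FixedPoint

theorem norm_map_mul_sub_le {E : Type*} [NormedRing E] {π ψ : E → ℂ} {a b : E} {c : ℝ}
    (hc : 0 ≤ c) (hmul : ψ (a * b) = ψ a * ψ b) (hψ : ‖ψ a‖ ≤ ‖a‖) (hπ : ‖π b‖ ≤ ‖b‖)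
    (ha : ‖π a - ψ a‖ ≤ c * ‖a‖) (hb : ‖π b - ψ b‖ ≤ c * ‖b‖)
    (hab : ‖π (a * b) - ψ (a * b)‖ ≤ c * ‖a * b‖) :
    ‖π (a * b) - π a * π b‖ ≤ 3 * c * (‖a‖ * ‖b‖) := by
  have hsplit : π (a * b) - π a * π b =
      (π (a * b) - ψ (a * b)) - ψ a * (π b - ψ b) - (π a - ψ a) * π b := by
    rw [hmul]
    ring
  calc ‖π (a * b) - π a * π b‖
      ≤ ‖π (a * b) - ψ (a * b)‖ + ‖ψ a‖ * ‖π b - ψ b‖ + ‖π a - ψ a‖ * ‖π b‖ := by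
        rw [hsplit, ← norm_mul, ← norm_mul]
        exact norm_sub_le_of_le (norm_sub_le _ _) le_rfl
    _ ≤ c * (‖a‖ * ‖b‖) + ‖a‖ * (c * ‖b‖) + c * ‖a‖ * ‖b‖ := by
        gcongr
        exact hab.trans (mul_le_mul_of_nonneg_left (norm_mul_le a b) hc)
    _ = 3 * c * (‖a‖ * ‖b‖) := by ring

variable {Γ : Type*} [DecidableEq Γ] {q : Γ → ℕ} {L : DissipativeInteraction q}
  {Λ X Y U V : Finset Γ} {π : Obs q Λ →ₗ[ℂ] ℂ} {g : ℝ → ℝ} {J : Finset (Region Λ)} {c t : ℝ}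

theorem IsLocalDynamicalFixedPoint.norm_sub_entryFunctional_flow_le
    (hπ : IsLocalDynamicalFixedPoint L Λ π g) (ht : 0 ≤ t) (σ : Config q Λ) {M : Obs q Λ}
    (hM : ‖flow (∑ Z, localMap L Λ Z) t M - flow (∑ Z ∈ J, localMap L Λ Z) t M‖ ≤ c * ‖M‖) :
    ‖π M - flow (∑ Z ∈ J, localMap L Λ Z) t M σ σ‖ ≤ (g t + c) * ‖M‖ := by
  have hσ := isState_entryFunctional σ
  have hconv := hπ.convergence _ hσ M t ht
  rw [hπ.invariant t ht, dynamics_apply] at hconv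
  rw [add_mul]
  exact (norm_sub_le_norm_sub_add_norm_sub _ _ _).trans
    (add_le_add hconv ((hσ.norm_apply_le _).trans hM))

theorem IsLocalDynamicalFixedPoint.norm_apply_embed_mul_embed_sub_le
    (hπ : IsLocalDynamicalFixedPoint L Λ π g) (hX : X ⊆ Λ) (hY : Y ⊆ Λ) (hXU : X ⊆ U)
    (hYV : Y ⊆ V) (hU : U ⊆ Λ) (hV : V ⊆ Λ) (hUV : Disjoint U V)
    (hJ : ∀ Z ∈ J, Z.1 ⊆ U ∨ Z.1 ⊆ V) (ht : 0 ≤ t)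
    (hflow : ∀ M ∈ localAlgebra q (Finset.union_subset hX hY),
      ‖flow (∑ Z, localMap L Λ Z) t M - flow (∑ Z ∈ J, localMap L Λ Z) t M‖ ≤ c * ‖M‖)
    (A : Obs q X) (B : Obs q Y) :
    ‖π (embed hX A * embed hY B) - π (embed hX A) * π (embed hY B)‖ ≤
      3 * (g t + c) * (‖A‖ * ‖B‖) := by
  obtain ⟨σ⟩ := hπ.isState.nonempty
  have : Nonempty (Config q Λ) := ⟨σ⟩
  have happrox (M) (hM) := hπ.norm_sub_entryFunctional_flow_le ht σ (hflow M hM)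
  have hc : 0 ≤ g t + c := by
    have hone := (norm_nonneg _).trans (happrox 1 (one_mem _))
    rwa [norm_one, mul_one] at hone
  have hAX := embed_mem_localAlgebra hX A
  have hBY := embed_mem_localAlgebra hY B
  have hAXY := localAlgebra_mono Finset.subset_union_left (Finset.union_subset hX hY) hAX
  have hBXY := localAlgebra_mono Finset.subset_union_right (Finset.union_subset hX hY) hBY
  refine (norm_map_mul_sub_le (ψ := fun M => flow (∑ Z ∈ J, localMap L Λ Z) t M σ σ) hc
    (flow_mul_apply_self L hU hV hUV hJ (localAlgebra_mono hXU hU hAX)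
      (localAlgebra_mono hYV hV hBY) t σ)
    (((isState_entryFunctional σ).norm_apply_le _).trans (norm_flow_localMap_apply_le L J ht _))
    (hπ.isState.norm_apply_le _) (happrox _ hAXY) (happrox _ hBXY)
    (happrox _ (mul_mem hAXY hBXY))).trans ?_
  gcongr
  · exact norm_embed_le hX A
  · exact norm_embed_le hY B

end FixedPoint

section Clustering

variable {Γ : Type*} [MetricSpace Γ] [DecidableEq Γ] {q : Γ → ℕ} {L : DissipativeInteraction q}
  {κ ν α ε δ η r : ℝ} {Λ X Y : Finset Γ}

/-- The bound on the relative error made at time `r ^ η / (e v)` by the decoupled dynamics on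
observables in two regions with `n` points in total. The division by `3` compensates for the factor
`3` in `correlationConst`. -/
def decouplingError (κ ν α ε δ η : ℝ) (L : DissipativeInteraction q) (n r : ℝ) : ℝ :=
  correlationConst κ ν α ε δ η L * n * (interactionNorm (powerLaw α) L).toReal *
    (1 / (1 + 2 * r) ^ ((1 - δ) * reducedExponent α ν ε - ν - η)) / 3

theorem norm_flow_sub_flow_decoupledRegions_le [Nonempty Γ] (hΓ : IsRegularSpace Γ κ ν)
    (hε : 0 < ε) (hα : 0 ≤ reducedExponent α ν ε) (hL : interactionNorm (powerLaw α) L < ⊤)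
    (hv : 0 < velocity α L) (hδ0 : 0 ≤ δ) (hδ1 : δ ≤ 1) (hη : 0 ≤ η) (hηδ : η ≤ δ)
    (hηp : η ≤ (1 - δ) * reducedExponent α ν ε - ν) (hX : X ⊆ Λ) (hY : Y ⊆ Λ) (hr : 1 ≤ r)
    {t : ℝ} (ht : t = r ^ η / (Real.exp 1 * velocity α L)) {M : Obs q Λ}
    (hM : M ∈ localAlgebra q (Finset.union_subset hX hY)) :
    ‖flow (∑ Z, localMap L Λ Z) t M -
        flow (∑ Z ∈ decoupledRegions Λ X Y r (r ^ (1 - δ)), localMap L Λ Z) t M‖ ≤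
      decouplingError κ ν α ε δ η L (X.card + Y.card) r * ‖M‖ := by
  have hr0 : 0 < r := zero_lt_one.trans_le hr
  have hflow := norm_flow_sub_flow_shortRegions_le (R := r ^ (1 - δ))
    (J := decoupledRegions Λ X Y r (r ^ (1 - δ))) hΓ hε hα hL (Finset.union_subset hX hY)
    (Finset.union_subset_union (subset_neighbourhood hX hr0) (subset_neighbourhood hY hr0))
    hr0.le (by positivity) (fun Z hZ => (mem_decoupledRegions.1 hZ).1)
    (fun Z hZ => (mem_decoupledRegions.1 hZ).2.elim (·.trans Finset.subset_union_left)
      (·.trans Finset.subset_union_right))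
    (fun Z hZ x hx => exists_le_dist_of_mem_shortRegions_sdiff hZ hx) hM
    (show 0 ≤ t by rw [ht]; positivity)
  have hevt : Real.exp 1 * velocity α L * t = r ^ η := by
    rw [ht]
    exact mul_div_cancel₀ _ (by positivity)
  have htail := tail_add_leak_le hr hΓ.nu_pos.le hΓ.kappa_pos.le hδ0 hδ1 hα hηδ (by positivity)
    (hΓ.card_neighbourhood_union_le Λ X Y hr0.le)
    (mod_cast Finset.card_union_le X Y : ((X ∪ Y).card : ℝ) ≤ X.card + Y.card)
  have hC := hΓ.le_localityConst (δ := δ) hε hα hδ1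
  have htime := rpow_mul_one_add_rpow_neg_le hr0.le hη hηp
  rw [hevt] at hflow
  have hκ := hΓ.kappa_pos
  have hζ := zetaConst_nonneg ε
  set a := reducedExponent α ν ε
  set n : ℝ := X.card + Y.card
  set l := (interactionNorm (powerLaw α) L).toReal with hl
  have hC0 : 0 ≤ localityConst Γ κ ν α ε δ := le_trans (by positivity) hC
  calc _ ≤ ‖M‖ * l * (κ * zetaConst ε) *
          (n * (κ * 2 ^ a + Real.exp 1) * (1 + r) ^ (-((1 - δ) * a - ν))) * t := by
        refine hflow.trans ?_
        rw [ht]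
        gcongr
    _ = ‖M‖ * n * l * (κ * zetaConst ε * (κ * 2 ^ a + Real.exp 1)) *
          ((r ^ η * (1 + r) ^ (-((1 - δ) * a - ν))) / (Real.exp 1 * velocity α L)) := by
        rw [ht]
        ring
    _ ≤ ‖M‖ * n * l * localityConst Γ κ ν α ε δ *
          ((2 ^ ((1 - δ) * a - ν - η) * (1 / (1 + 2 * r) ^ ((1 - δ) * a - ν - η))) /
            (Real.exp 1 * velocity α L)) := by
        gcongr
    _ = _ := by
        rw [decouplingError, correlationConst]
        ring

end Clustering

end OpenSpin

end

theorem lemma3p6 {Γ : Type*} [DecidableEq Γ] [Countable Γ] [MetricSpace Γ] {q : Γ → ℕ}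
    {κ ν : ℝ} (hΓ : OpenSpin.IsRegularSpace Γ κ ν)
    {α : ℝ} (hα : 2 * ν + 1 < α)
    (L : OpenSpin.DissipativeInteraction q)
    (hL : OpenSpin.interactionNorm (OpenSpin.powerLaw α) L < ⊤)
    (hL0 : 0 < OpenSpin.interactionNorm (OpenSpin.powerLaw α) L)
    {ε : ℝ} (hε : ε ∈ Set.Ioo 0 (α - 2 * ν - 1))
    {δ : ℝ} (hδ : δ ∈ Set.Ioo (0 : ℝ) 1) (hδα : ν < (1 - δ) * OpenSpin.reducedExponent α ν ε)
    (Λ : Finset Γ) (π : OpenSpin.Obs q Λ →ₗ[ℂ] ℂ) (g : ℝ → ℝ)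
    (hπ : OpenSpin.IsLocalDynamicalFixedPoint L Λ π g)
    (X Y : Finset Γ) (hX : X ⊆ Λ) (hY : Y ⊆ Λ) (hXY : 2 < OpenSpin.setDist X Y)
    (A : OpenSpin.Obs q X) (B : OpenSpin.Obs q Y)
    {η : ℝ} (hη : 0 < η) (hη' : η < min δ ((1 - δ) * OpenSpin.reducedExponent α ν ε - ν)) :
    ‖π (OpenSpin.embed hX A * OpenSpin.embed hY B) -
        π (OpenSpin.embed hX A) * π (OpenSpin.embed hY B)‖ ≤
      OpenSpin.correlationConst κ ν α ε δ η L * ‖A‖ * ‖B‖ * ((X.card : ℝ) + (Y.card : ℝ)) *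
          (OpenSpin.interactionNorm (OpenSpin.powerLaw α) L).toReal *
          (1 / (1 + OpenSpin.setDist X Y) ^ ((1 - δ) * OpenSpin.reducedExponent α ν ε - ν - η)) +
        3 * ‖A‖ * ‖B‖ *
          g (OpenSpin.setDist X Y ^ η / (Real.exp 1 * OpenSpin.velocity α L * 2 ^ η)) := by
  open OpenSpin in
  have : Nonempty Γ := nonempty_of_setDist_pos (zero_lt_two.trans hXY)
  have hα0 : 0 ≤ reducedExponent α ν ε := by
    unfold reducedExponent
    linarith [hε.2, hΓ.nu_pos]
  have hv := hΓ.velocity_pos hε.1 hα0 hL hL0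
  obtain ⟨hηδ, hηp⟩ := lt_min_iff.1 hη'
  obtain ⟨r, hr⟩ : ∃ r, setDist X Y = 2 * r := ⟨setDist X Y / 2, by ring⟩
  have hr1 : 1 ≤ r := by linarith
  have hr0 : 0 < r := by linarith
  have htime : (2 * r) ^ η / (Real.exp 1 * velocity α L * 2 ^ η) =
      r ^ η / (Real.exp 1 * velocity α L) := by
    rw [Real.mul_rpow zero_le_two hr0.le, mul_comm, mul_div_mul_right _ _ (by positivity)]
  have hcluster := hπ.norm_apply_embed_mul_embed_sub_le hX hY (subset_neighbourhood hX hr0)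
    (subset_neighbourhood hY hr0) neighbourhood_subset neighbourhood_subset
    (disjoint_neighbourhood fun x hx y hy => hr ▸ setDist_le_dist hx hy)
    (fun Z hZ => (mem_decoupledRegions.1 hZ).2) (by positivity)
    (fun M hM => norm_flow_sub_flow_decoupledRegions_le hΓ hε.1 hα0 hL hv hδ.1.le hδ.2.le hη.le
      hηδ.le hηp.le hX hY hr1 rfl hM) A B
  rw [hr, htime]
  refine hcluster.trans_eq ?_
  rw [decouplingError]
  ring
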